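/- All graphs are finite and simple. Let $G$ be a graph. A maximum matching of $G$ is a matching with the largest number of edges, and an edge of $G$ is allowed if it lies in some maximum matching of $G$. Let $C_1,\dots,C_k$ be the vertex sets of the connected components of the spanning subgraph of $G$ formed by all allowed edges; the induced subgraphs $G[C_1],\dots,G[C_k]$ are the factor-components of $G$. A set $X\subseteq V(G)$ is separating if it is the union of the vertex sets of one or more factor-components. A graph is factor-critical if for each of its vertices $v$ it has a matching covering exactly the vertices other than $v$. For factor-components $H_1,H_2$ of $G$ write $H_1\trianglelefteq H_2$ if there is a separating set $X$ with $V(H_1)\cup V(H_2)\subseteq X$ such that the graph $G[X]/H_1$, obtained from $G[X]$ by contracting $V(H_1)$ to a single vertex, is factor-critical. An ear relative to a set $X\subseteq V(G)$ is a subgraph $P$ of $G$ that is either a path with two distinct ends in $X$ and no other vertex in $X$, or a circuit with exactly one vertex in $X$; its internal vertices are those in $V(P)\setminus X$. For a matching $M$, the ear $P$ is an $M$-ear if $P-X$ is a path $Q$ for which $M\cap E(Q)$ is a perfect matching of $Q$. The ear $P$ is relative to a factor-component $H$ if it is relative to $V(H)$, and it traverses a factor-component $H'$ if some internal vertex of $P$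 lies in $V(H')$. Proposition. Let $G$ be a graph and $M$ a maximum matching of $G$. Let $G_1$ and $G_2$ be distinct factor-components of $G$ with $G_1\trianglelefteq G_2$, and suppose that $G_1$ and $G_2$ are immediate, that is, for every factor-component $H$ of $G$, if $G_1\trianglelefteq H\trianglelefteq G_2$ then $G_1=H$ or $G_2=H$. Then there is an $M$-ear relative to $G_1$ that traverses $G_2$. -/

import Mathlib

/-! Matchings, factor-components, the basilica order and ears in finite graphs. -/

namespace Basilica

variable {V : Type*}

/-- `M` is a maximum matching of `G`: a matching with the largest number of edges. A matching is
given as the subgraph consisting of its edges and of the vertices that these edges cover. -/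
def IsMaximumMatching (G : SimpleGraph V) (M : G.Subgraph) : Prop :=
  M.IsMatching ∧ ∀ N : G.Subgraph, N.IsMatching → N.edgeSet.ncard ≤ M.edgeSet.ncard

/-- The spanning subgraph of `G` formed by the allowed edges, that is, by the edges that are
contained in some maximum matching of `G`. -/
def allowedGraph (G : SimpleGraph V) : SimpleGraph V where
  Adj u v := ∃ M : G.Subgraph, IsMaximumMatching G M ∧ M.Adj u v
  symm := ⟨fun _ _ ⟨M, hM, h⟩ => ⟨M, hM, h.symm⟩⟩
  loopless := ⟨fun _ ⟨_, _, h⟩ => h.ne rfl⟩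

/-- The factor-components of `G`: the subgraphs of `G` induced by the vertex sets of the connected
components of the graph of allowed edges. -/
def factorComponents (G : SimpleGraph V) : Set G.Subgraph :=
  {H | ∃ C : (allowedGraph G).ConnectedComponent, H = (⊤ : G.Subgraph).induce C.supp}

/-- A set of vertices is separating if it is the union of the vertex sets of at least one
factor-component (distinct factor-components are disjoint). -/
def IsSeparating (G : SimpleGraph V) (X : Set V) : Prop :=
  ∃ S : Set G.Subgraph, S ⊆ factorComponents G ∧ S.Nonempty ∧ X = ⋃ H ∈ S, H.verts

/-- The contraction `G / S`: the vertices in `S` are replaced by the single new vertex `none`, which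
is joined to all vertices outside `S` that have a neighbour in `S`. -/
def contract (G : SimpleGraph V) (S : Set V) : SimpleGraph (Option {v : V // v ∉ S}) where
  Adj
    | none, none => False
    | none, some v => ∃ u ∈ S, G.Adj u v
    | some v, none => ∃ u ∈ S, G.Adj u v
    | some v, some w => G.Adj v w
  symm := ⟨by
    rintro (_ | v) (_ | w) h
    · exact h
    · exact h
    · exact h
    · exact SimpleGraph.Adj.symm h⟩
  loopless := ⟨by
    rintro (_ | v) h
    · exact h
    · exact G.loopless.irrefl _ h⟩

/-- A graph is factor-critical if for every vertex `v` it has a matching that covers exactly the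
vertices other than `v`. -/
def IsFactorCritical {W : Type*} (G : SimpleGraph W) : Prop :=
  ∀ v : W, ∃ M : G.Subgraph, M.IsMatching ∧ M.verts = {v}ᶜ

/-- `X` is a critical-inducing set for the factor-component `H`: a separating set that contains the
vertices of `H`, for which `G[X] / H` is factor-critical. -/
def IsCriticalInducing (G : SimpleGraph V) (H : G.Subgraph) (X : Set V) : Prop :=
  IsSeparating G X ∧ H.verts ⊆ X ∧
    IsFactorCritical (contract (G.induce X) {v : X | (v : V) ∈ H.verts})

/-- The basilica order `H₁ ⊴ H₂` on factor-components: there is a critical-inducing set for `H₁`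
to `H₂`. -/
def BasilicaLE (G : SimpleGraph V) (H₁ H₂ : G.Subgraph) : Prop :=
  ∃ X : Set V, IsCriticalInducing G H₁ X ∧ H₂.verts ⊆ X

/-- `P` is an ear relative to `X`: a path with two distinct ends in `X` and no other vertex in `X`,
or a circuit with exactly one vertex in `X`. -/
def IsEar (G : SimpleGraph V) (X : Set V) (P : G.Subgraph) : Prop :=
  (∃ (u v : V) (p : G.Walk u v), p.IsPath ∧ u ≠ v ∧ P = p.toSubgraph ∧ P.verts ∩ X = {u, v}) ∨
  (∃ (u : V) (p : G.Walk u u), p.IsCycle ∧ P = p.toSubgraph ∧ P.verts ∩ X = {u})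

/-- `Q` is an `M`-saturated path: a path such that the edges of `M` on `Q` form a perfect matching
of `Q`. -/
def IsSaturatedPath (G : SimpleGraph V) (M Q : G.Subgraph) : Prop :=
  (∃ (u v : V) (q : G.Walk u v), q.IsPath ∧ Q = q.toSubgraph) ∧
    ∀ v ∈ Q.verts, ∃! w, M.Adj v w ∧ Q.Adj v w

/-- `P` is an `M`-ear relative to `X`: an ear for which `P - X` is an `M`-saturated path. -/
def IsMatchingEar (G : SimpleGraph V) (M : G.Subgraph) (X : Set V) (P : G.Subgraph) : Prop :=
  IsEar G X P ∧ IsSaturatedPath G M (P.deleteVerts X)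

/-- An ear `P` relative to `X` traverses `Y` if one of its internal vertices, that is, one of its
vertices outside `X`, belongs to `Y`. -/
def Traverses {G : SimpleGraph V} (P : G.Subgraph) (X Y : Set V) : Prop :=
  ((P.verts \ X) ∩ Y).Nonempty

/-- Two factor-components are immediate if no other factor-component lies between them. -/
def IsImmediate (G : SimpleGraph V) (H₁ H₂ : G.Subgraph) : Prop :=
  ∀ H ∈ factorComponents G, BasilicaLE G H₁ H → BasilicaLE G H H₂ → H₁ = H ∨ H₂ = H

end Basilica

namespace Basilica

variable {V : Type*}

/-! Let X be a set witnessing G₁ ⊴ G₂. Relative to a maximum matching, factor-criticality of G[X]/G₁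
means that every vertex of X reaches G₁ inside X by an alternating path that starts with a matching
edge and ends with a non-matching one, or is empty (`isCriticalInducing_iff`). This property
survives adding an ear to a separating set together with all factor-components the ear meets
(`Crit.extend`). Hence a factor-component met by an ear relative to G₁ inside X lies above G₁
(`EarThrough.compLE`).

The heart is `exists_earThrough_compLE`: every vertex of X outside G₁ lies above some
factor-component met by an ear relative to G₁. Grow a separating set U from G₁ by ears. An ear
relative to U is prolonged at both ends by alternating paths in U towards G₁ (`exists_earThrough`).
If these are disjoint, an ear relative to G₁ results. If they merge, an ear relative to the
factor-component T of the merging vertex results. If they meet in opposite directions, an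
alternating circuit arises, so an edge leaving U is allowed, which is impossible. When T differs
from G₁, it already lies above a factor-component met by an ear of G₁, and transitivity
(`CompLE.trans`) finishes.

Applied to G₂ this gives a factor-component H ≠ G₁, met by an ear relative to G₁, with G₁ ⊴ H ⊴ G₂.
Immediacy forces H = G₂. -/

/-- The involution `m` describes a matching of `G`: it exchanges the ends of the matching edges and
fixes all other vertices. -/
def IsMat (G : SimpleGraph V) (m : V → V) : Prop :=
  (∀ v, m (m v) = v) ∧ ∀ v, m v ≠ v → G.Adj v (m v)

/-- The path `z, m z, y₁, m y₁, …, h` for `L = [z, y₁, …]`. -/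
def EvenPath (G : SimpleGraph V) (m : V → V) : V → List V → V → Prop
  | z, [], h => z = h
  | z, y :: L, h => z = y ∧ ∃ w, G.Adj (m y) w ∧ EvenPath G m w L h

/-- The ear `a, y₁, m y₁, y₂, …, b` for `L = [y₁, y₂, …]`. -/
def ListEar (G : SimpleGraph V) (m : V → V) (a : V) (L : List V) (b : V) : Prop :=
  ∃ w, G.Adj a w ∧ EvenPath G m w L b

/-- The sets `{y, m y}` for the members `y` of `L` are pairwise disjoint and of size two. -/
def DisjointPairs (m : V → V) (L : List V) : Prop :=
  L.Pairwise (fun a b => b ≠ a ∧ b ≠ m a) ∧ ∀ a ∈ L, m a ≠ a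

/-! ### Alternating paths and ears as lists -/

section Lists

variable {G : SimpleGraph V} {m : V → V}

theorem evenPath_append {z h : V} {L₁ L₂ : List V} :
    EvenPath G m z (L₁ ++ L₂) h ↔ ∃ c, EvenPath G m z L₁ c ∧ EvenPath G m c L₂ h := by
  induction L₁ generalizing z with
  | nil => simp [EvenPath]
  | cons y L ih =>
    simp only [List.cons_append, EvenPath, ih]
    constructor
    · rintro ⟨rfl, w, hw, c, h1, h2⟩
      exact ⟨c, ⟨rfl, w, hw, h1⟩, h2⟩
    · rintro ⟨c, ⟨rfl, w, hw, h1⟩, h2⟩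
      exact ⟨rfl, w, hw, c, h1, h2⟩

theorem listEar_nil {a b : V} : ListEar G m a [] b ↔ G.Adj a b := by
  simp [ListEar, EvenPath]

theorem listEar_cons {a b y : V} {L : List V} :
    ListEar G m a (y :: L) b ↔ G.Adj a y ∧ ListEar G m (m y) L b := by
  simp [ListEar, EvenPath]

theorem evenPath_cons {z y h : V} {L : List V} :
    EvenPath G m z (y :: L) h ↔ z = y ∧ ListEar G m (m y) L h := by
  simp [ListEar, EvenPath]

theorem listEar_append {a b : V} {L₁ L₂ : List V} :
    ListEar G m a (L₁ ++ L₂) b ↔ ∃ c, ListEar G m a L₁ c ∧ EvenPath G m c L₂ b := by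
  simp only [ListEar, evenPath_append]
  constructor
  · rintro ⟨w, hw, c, h1, h2⟩
    exact ⟨c, ⟨w, hw, h1⟩, h2⟩
  · rintro ⟨c, ⟨w, hw, h1⟩, h2⟩
    exact ⟨w, hw, c, h1, h2⟩

theorem listEar_append_cons {a b y : V} {L₁ L₂ : List V} :
    ListEar G m a (L₁ ++ y :: L₂) b ↔ ListEar G m a L₁ y ∧ ListEar G m (m y) L₂ b := by
  simp only [listEar_append, evenPath_cons]
  constructor
  · rintro ⟨c, h1, rfl, h2⟩
    exact ⟨h1, h2⟩
  · rintro ⟨h1, h2⟩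
    exact ⟨y, h1, rfl, h2⟩

theorem ListEar.reverse (hm : ∀ v, m (m v) = v) {a b : V} {L : List V}
    (h : ListEar G m a L b) : ListEar G m b (L.reverse.map m) a := by
  induction L generalizing a with
  | nil => rw [listEar_nil] at h; simpa [listEar_nil] using h.symm
  | cons y L ih =>
    rw [listEar_cons] at h
    simp only [List.reverse_cons, List.map_append, List.map_cons, List.map_nil]
    rw [listEar_append_cons, hm, listEar_nil]
    exact ⟨ih h.2, h.1.symm⟩

theorem reverse_map_reverse_map (hm : ∀ v, m (m v) = v) (L : List V) :
    (L.reverse.map m).reverse.map m = L := by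
  simp [← List.map_reverse, Function.comp_def, hm]

theorem mem_reverse_map (hm : ∀ v, m (m v) = v) {v : V} {L : List V} :
    v ∈ L.reverse.map m ↔ m v ∈ L := by
  simp only [List.mem_map, List.mem_reverse]
  constructor
  · rintro ⟨a, ha, rfl⟩
    rwa [hm]
  · intro h
    exact ⟨m v, h, hm v⟩

/-- An even path from `a` and an ear at `a` can be joined at `a`. -/
theorem EvenPath.reverse_append (hm : ∀ v, m (m v) = v) {a b g : V} {L E : List V}
    (hL : EvenPath G m a L g) (hE : ListEar G m a E b) :
    ListEar G m g (L.reverse.map m ++ E) b := by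
  have h := (listEar_append.2 ⟨a, hE.reverse hm, hL⟩).reverse hm
  rw [List.reverse_append, List.map_append, reverse_map_reverse_map hm] at h
  exact h

theorem disjointPairs_cons {y : V} {L : List V} :
    DisjointPairs m (y :: L) ↔
      (∀ b ∈ L, b ≠ y ∧ b ≠ m y) ∧ m y ≠ y ∧ DisjointPairs m L := by
  simp only [DisjointPairs, List.pairwise_cons, List.mem_cons, forall_eq_or_imp]
  tauto

theorem disjointPairs_append {L₁ L₂ : List V} :
    DisjointPairs m (L₁ ++ L₂) ↔
      DisjointPairs m L₁ ∧ DisjointPairs m L₂ ∧ ∀ a ∈ L₁, ∀ b ∈ L₂, b ≠ a ∧ b ≠ m a := by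
  simp only [DisjointPairs, List.pairwise_append, List.mem_append, or_imp, forall_and]
  tauto

theorem DisjointPairs.reverse (hm : ∀ v, m (m v) = v) {L : List V} (h : DisjointPairs m L) :
    DisjointPairs m (L.reverse.map m) := by
  refine ⟨?_, ?_⟩
  · rw [List.pairwise_map, List.pairwise_reverse]
    refine h.1.imp ?_
    rintro a b ⟨h1, h2⟩
    refine ⟨fun h => h1 ?_, fun h => h2 ?_⟩
    · rw [← hm a, h, hm]
    · rw [hm] at h; exact h.symm
  · intro a ha hfix
    rw [mem_reverse_map hm] at ha
    exact h.2 _ ha (by rw [hm, hfix])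

theorem exists_split_first {L : List V} {p : V → Prop} (h : ∃ x ∈ L, p x) :
    ∃ L₁ c L₂, L = L₁ ++ c :: L₂ ∧ p c ∧ ∀ a ∈ L₁, ¬ p a := by
  induction L with
  | nil => simp at h
  | cons y L ih =>
    by_cases hy : p y
    · exact ⟨[], y, L, rfl, hy, by simp⟩
    · obtain ⟨x, hx, hpx⟩ := h
      obtain ⟨L₁, c, L₂, rfl, hc, hL⟩ := ih ⟨x, by grind, hpx⟩
      exact ⟨y :: L₁, c, L₂, rfl, hc, by grind⟩

/-- An even path ending in `Y` has an initial part that ends where the path enters `Y`. -/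
theorem EvenPath.truncate {z h : V} {L : List V} (hL : EvenPath G m z L h) {Y : Set V}
    (hh : h ∈ Y) :
    ∃ L₁ L₂ c, L = L₁ ++ L₂ ∧ EvenPath G m z L₁ c ∧ EvenPath G m c L₂ h ∧ c ∈ Y ∧
      (L₂ = [] ∨ c ∈ L₂) ∧ ∀ a ∈ L₁, a ∉ Y := by
  by_cases hx : ∃ x ∈ L, x ∈ Y
  · obtain ⟨L₁, c, L₂, rfl, hc, hL₁⟩ := exists_split_first hx
    obtain ⟨d, h1, h2⟩ := evenPath_append.1 hL
    obtain rfl := (evenPath_cons.1 h2).1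
    exact ⟨L₁, _, d, rfl, h1, h2, hc, by simp, hL₁⟩
  · push Not at hx
    exact ⟨L, [], h, by simp, hL, rfl, hh, by simp, hx⟩

end Lists

/-! ### Local changes of matchings -/

section Involutions

variable {G : SimpleGraph V}

open Classical in
/-- Add the edge `pq` to the matching `n`. -/
noncomputable def join (n : V → V) (p q : V) : V → V :=
  fun v => if v = p then q else if v = q then p else n v

open Classical in
/-- Remove the edge at `p` from the matching `n`. -/
noncomputable def cut (n : V → V) (p : V) : V → V :=
  fun v => if v = p ∨ v = n p then v else n v

open Classical in
/-- Use the matching `n` in `S` and the matching `m` outside `S`. -/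
noncomputable def glue (S : Set V) (n m : V → V) : V → V :=
  fun v => if v ∈ S then n v else m v

theorem IsMat.join {n : V → V} (hn : IsMat G n) {p q : V} (hp : n p = p) (hq : n q = q)
    (h : G.Adj p q) : IsMat G (join n p q) := by
  have h' := h.symm
  obtain ⟨h1, h2⟩ := hn
  constructor
  · intro v; have := h1 v; unfold Basilica.join; grind
  · intro v; have := h2 v; unfold Basilica.join; grind

theorem IsMat.cut {n : V → V} (hn : IsMat G n) (p : V) : IsMat G (cut n p) := by
  obtain ⟨h1, h2⟩ := hn
  constructor
  · intro v; have := h1 v; have := h1 p; unfold Basilica.cut; grind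
  · intro v; have := h2 v; unfold Basilica.cut; grind

theorem IsMat.glue {n m : V → V} (hn : IsMat G n) (hm : IsMat G m) {S : Set V}
    (hnS : ∀ v ∈ S, n v ∈ S) (hmS : ∀ v ∈ S, m v ∈ S) : IsMat G (glue S n m) := by
  obtain ⟨h1, h2⟩ := hn
  obtain ⟨h3, h4⟩ := hm
  constructor
  · intro v; have := h1 v; have := h3 v; have := hnS v; have := hmS (m v); unfold Basilica.glue; grind
  · intro v; have := h2 v; have := h4 v; unfold Basilica.glue; grind

theorem isMat_id : IsMat G (id : V → V) := ⟨fun _ => rfl, fun _ h => (h rfl).elim⟩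

/-- The path prolonged by the last matching edge has distinct ends. These are the two vertices
exposed by an exchange along it. -/
theorem EvenPath.partner_last_ne {G : SimpleGraph V} {m : V → V} (hm : ∀ v, m (m v) = v) {z y : V}
    {L : List V} (hL : EvenPath G m z L y) (hd : DisjointPairs m (L ++ [y])) : m y ≠ z := by
  cases L with
  | nil => obtain rfl : z = y := hL; exact hd.2 z (by simp)
  | cons x L =>
    obtain ⟨rfl, -⟩ := hL
    rw [List.cons_append, disjointPairs_cons] at hd
    have := hd.1 y (by simp)
    have := hm y
    grind

/-- Exchanging the matching along an alternating path. -/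
theorem exists_switch {m : V → V} (hm : IsMat G m) {z y : V} {L : List V}
    (hL : EvenPath G m z L y) (hd : DisjointPairs m (L ++ [y])) :
    ∃ n, IsMat G n ∧ n z = z ∧ n (m y) = m y ∧
      (∀ v, v ∉ L ++ [y] → m v ∉ L ++ [y] → n v = m v) ∧
      ∀ v, (v ∈ L ++ [y] ∨ m v ∈ L ++ [y]) →
        (n v ∈ L ++ [y] ∨ m (n v) ∈ L ++ [y]) ∧ (v ≠ z → v ≠ m y → n v ≠ v) := by
  induction L generalizing z with
  | nil =>
    obtain rfl : z = y := hL
    have h1 := hm.1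
    refine ⟨cut m z, hm.cut z, ?_⟩
    unfold cut
    grind
  | cons x L ih =>
    obtain ⟨rfl, w, hw, hL'⟩ := hL
    rw [List.cons_append, disjointPairs_cons] at hd
    obtain ⟨hd1, hd2, hd3⟩ := hd
    obtain ⟨n, hn, hnw, hny, hoff, hon⟩ := ih hL' hd3
    have hwm : w ∈ L ++ [y] := by
      cases L with
      | nil => simp [show w = y from hL']
      | cons a L => simp [hL'.1]
    have h1 := hm.1
    have h2 := hn.1
    have hz : z ∉ L ++ [y] := fun h => (hd1 z h).1 rfl
    have hz' : m z ∉ L ++ [y] := fun h => (hd1 _ h).2 rfl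
    have hnz : n z = m z := hoff z hz hz'
    have hnmz : n (m z) = z := by rw [hoff _ hz' (by rwa [h1]), h1]
    -- The exchange along the tail exposes `w`. Dropping the edge from `z` to `m z` and matching `m
    -- z` to `w` moves the exposed vertex back to `z`.
    refine ⟨join (cut n z) (m z) w, (hn.cut z).join ?_ ?_ hw, ?_, ?_, ?_, ?_⟩
    · unfold cut; grind
    · unfold cut; grind
    · unfold join cut; grind
    · have hy : y ∈ L ++ [y] := by simp
      have hyw := hL'.partner_last_ne h1 hd3
      clear hoff hon ih
      unfold join cut; grind
    · intro v hv hv'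
      have := hoff v
      unfold join cut; grind
    · intro v hv
      have := hoff v
      have := hon v
      have := h1 v
      have := h1 z
      have := h1 (n v)
      have hy : y ∈ L ++ [y] := by simp
      rw [List.cons_append]
      simp only [List.mem_cons] at hv ⊢
      unfold join cut
      constructor
      · grind
      · grind

end Involutions

/-- The component of `z` in the symmetric difference of two matchings, where `z` is not covered by
the second one, followed from `z` until it enters `Y`. -/
theorem exists_alternating_path [Finite V] {G : SimpleGraph V} {m n : V → V} (hm : IsMat G m)
    (hn : IsMat G n) {Y : Set V} (hmY : ∀ v ∉ Y, m v ∉ Y) (hfix : ∀ v ∉ Y, m v ≠ v)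
    {z : V} (hz : z ∉ Y) (hnz : n z = z) :
    ∃ L y, EvenPath G m z L y ∧ DisjointPairs m (L ++ [y]) ∧
      (∀ a ∈ L ++ [y], a ∉ Y ∧ m a ≠ n a) ∧
      (n (m y) = m y ∨ ∃ e ∈ Y, n e ∉ Y ∧ G.Adj (m y) e) := by
  induction hN : {v | m v ≠ n v}.ncard using Nat.strong_induction_on generalizing n z with
  | _ N ih =>
  have h1 := hm.1
  have h2 := hn.1
  have hmz := hfix z hz
  by_cases hA : n (m z) = m z
  · exact ⟨[], z, rfl, by simp [DisjointPairs, hmz], by simp [hz, hnz, hmz], .inl hA⟩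
  have hadj := hn.2 _ hA
  by_cases hB : n (m z) ∈ Y
  · refine ⟨[], z, rfl, by simp [DisjointPairs, hmz], by simp [hz, hnz, hmz],
      .inr ⟨_, hB, ?_, hadj⟩⟩
    rw [h2]; exact hmY z hz
  set w := n (m z) with hw
  have hnw : n w = m z := by rw [hw, h2]
  -- Giving `n` the `m`-edge at `z` exposes `w` and lowers the number of vertices where the
  -- matchings differ, so the induction continues from `w`.
  have hn' : IsMat G (join (cut n (m z)) z (m z)) := by
    refine (hn.cut _).join ?_ ?_ (hm.2 z hmz)
    · unfold cut; grind
    · unfold cut; grind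
  obtain ⟨L, y, hL, hd, hLY, hend⟩ := ih _ (by
      rw [← hN]
      apply Set.ncard_lt_ncard _ (Set.toFinite _)
      refine ⟨fun v hv => ?_, fun h => ?_⟩
      · simp only [Set.mem_ofPred_eq] at hv ⊢
        have := h1 v
        unfold join cut at hv; grind
      · have := @h z (by simp [hnz, hmz])
        simp [join] at this) hn' hB (by unfold join cut; grind) rfl
  have hzL : ∀ a ∈ L ++ [y], a ≠ z ∧ a ≠ m z := by
    intro a ha
    have hne := (hLY a ha).2
    have := h1 z
    unfold join cut at hne
    grind
  refine ⟨z :: L, y, ⟨rfl, w, hadj, hL⟩, ?_, ?_, ?_⟩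
  · rw [List.cons_append, disjointPairs_cons]
    exact ⟨hzL, hmz, hd⟩
  · intro a ha
    rw [List.cons_append, List.mem_cons] at ha
    rcases ha with rfl | ha
    · exact ⟨hz, by rw [hnz]; exact hmz⟩
    · refine ⟨(hLY a ha).1, ?_⟩
      have hne := (hLY a ha).2
      have := h1 a
      have := hzL a ha
      unfold join cut at hne
      grind
  · have hy : y ∈ L ++ [y] := by simp
    have hyz := hzL y hy
    have hmy : m y ≠ w := hL.partner_last_ne h1 hd
    rcases hend with hend | ⟨e, heY, hne, hadj'⟩
    · left
      have := h1 y
      have := h1 z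
      unfold join cut at hend
      grind
    · right
      refine ⟨e, heY, ?_, hadj'⟩
      have := hmY z hz
      unfold join cut at hne
      grind

/-! ### Matchings as subgraphs and as involutions -/

theorem exists_isMat_of_rel {G : SimpleGraph V} (R : V → V → Prop) (hsymm : ∀ u v, R u v → R v u)
    (hfun : ∀ u v w, R u v → R u w → v = w) (hadj : ∀ u v, R u v → G.Adj u v) :
    ∃ n, IsMat G n ∧ ∀ u v, R u v ↔ n u = v ∧ u ≠ v := by
  classical
  let n : V → V := fun u => if h : ∃ v, R u v then h.choose else u
  have h1 : ∀ u v, R u v → n u = v := by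
    intro u v h
    have hex : ∃ v, R u v := ⟨v, h⟩
    simp only [n, dif_pos hex]
    exact hfun u _ _ hex.choose_spec h
  have h2 : ∀ u, (¬ ∃ v, R u v) → n u = u := fun u h => by simp only [n, dif_neg h]
  have h3 : ∀ u v, R u v ↔ n u = v ∧ u ≠ v := by
    intro u v
    refine ⟨fun h => ⟨h1 u v h, (hadj u v h).ne⟩, ?_⟩
    rintro ⟨rfl, hne⟩
    by_cases hex : ∃ v, R u v
    · obtain ⟨v, hv⟩ := hex
      rwa [h1 u v hv]
    · exact (hne (h2 u hex).symm).elim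
  refine ⟨n, ⟨fun u => ?_, fun u hu => hadj _ _ ((h3 _ _).2 ⟨rfl, hu.symm⟩)⟩, h3⟩
  by_cases hex : ∃ v, R u v
  · obtain ⟨v, hv⟩ := hex
    rw [h1 u v hv, h1 v u (hsymm _ _ hv)]
  · rw [h2 u hex, h2 u hex]

/-- The involution `n` exchanges the ends of the edges of `M`. -/
def Represents {G : SimpleGraph V} (n : V → V) (M : G.Subgraph) : Prop :=
  ∀ u v, M.Adj u v ↔ n u = v ∧ u ≠ v

theorem _root_.SimpleGraph.Subgraph.IsMatching.exists_represents {G : SimpleGraph V}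
    {M : G.Subgraph} (hM : M.IsMatching) : ∃ n, IsMat G n ∧ Represents n M :=
  exists_isMat_of_rel M.Adj (fun _ _ h => h.symm) (fun _ _ _ h h' => hM.eq_of_adj_left h h')
    (fun _ _ h => h.adj_sub)

theorem Represents.mem_verts {G : SimpleGraph V} {n : V → V} {M : G.Subgraph}
    (h : Represents n M) (hM : M.IsMatching) (v : V) : v ∈ M.verts ↔ n v ≠ v := by
  constructor
  · intro hv
    obtain ⟨w, hw, -⟩ := hM hv
    obtain ⟨rfl, hne⟩ := (h v w).1 hw
    exact hne.symm
  · intro hv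
    exact ((h v (n v)).2 ⟨rfl, hv.symm⟩).fst_mem

/-- The matching described by an involution. -/
def IsMat.toSubgraph {G : SimpleGraph V} {n : V → V} (hn : IsMat G n) : G.Subgraph where
  verts := {v | n v ≠ v}
  Adj u v := n u = v ∧ u ≠ v
  adj_sub := by
    rintro u v ⟨rfl, h⟩
    exact hn.2 u h.symm
  edge_vert := by
    rintro u v ⟨rfl, h⟩
    exact h.symm
  symm := ⟨by
    rintro u v ⟨rfl, h⟩
    exact ⟨hn.1 u, h.symm⟩⟩

theorem IsMat.toSubgraph_isMatching {G : SimpleGraph V} {n : V → V} (hn : IsMat G n) :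
    hn.toSubgraph.IsMatching := by
  intro v hv
  refine ⟨n v, ⟨rfl, fun h => hv h.symm⟩, ?_⟩
  rintro w ⟨rfl, -⟩
  rfl

theorem IsMat.represents {G : SimpleGraph V} {n : V → V} (hn : IsMat G n) :
    Represents n hn.toSubgraph := fun _ _ => Iff.rfl

theorem two_mul_ncard_edgeSet [Finite V] {G : SimpleGraph V} {M : G.Subgraph}
    (hM : M.IsMatching) : 2 * M.edgeSet.ncard = M.verts.ncard := by
  classical
  have := Fintype.ofFinite V
  have h1 := M.spanningCoe.sum_degrees_eq_twice_card_edges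
  have h2 : M.spanningCoe.edgeFinset.card = M.edgeSet.ncard := by
    rw [← M.edgeSet_spanningCoe, ← SimpleGraph.coe_edgeFinset, Set.ncard_coe_finset]
  have h3 : ∀ v, M.spanningCoe.degree v = if v ∈ M.verts then 1 else 0 := by
    intro v
    rw [SimpleGraph.Subgraph.degree_spanningCoe]
    split_ifs with hv
    · exact SimpleGraph.Subgraph.degree_eq_one_iff_existsUnique_adj.2 (hM hv)
    · exact SimpleGraph.Subgraph.degree_of_notMem_verts hv
  rw [h2] at h1
  rw [← h1, Finset.sum_congr rfl fun v _ => h3 v, Finset.sum_boole, Set.ncard_eq_toFinset_card']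
  simp only [Set.filter_mem_univ_eq_toFinset, Nat.cast_id]

/-- The involution describes a maximum matching. -/
def MaxMat (G : SimpleGraph V) (n : V → V) : Prop :=
  IsMat G n ∧ ∀ n', IsMat G n' → {v | n' v ≠ v}.ncard ≤ {v | n v ≠ v}.ncard

theorem Represents.isMaximumMatching_iff [Finite V] {G : SimpleGraph V} {n : V → V}
    {M : G.Subgraph} (h : Represents n M) (hM : M.IsMatching) (hn : IsMat G n) :
    IsMaximumMatching G M ↔ MaxMat G n := by
  have key : ∀ (n : V → V) (M : G.Subgraph), Represents n M → M.IsMatching →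
      {v | n v ≠ v}.ncard = 2 * M.edgeSet.ncard := by
    intro n M h hM
    rw [two_mul_ncard_edgeSet hM]
    congr 1
    ext v
    exact (h.mem_verts hM v).symm
  constructor
  · rintro ⟨-, hmax⟩
    refine ⟨hn, fun n' hn' => ?_⟩
    have := hmax _ hn'.toSubgraph_isMatching
    rw [key n M h hM, key n' _ hn'.represents hn'.toSubgraph_isMatching]
    omega
  · rintro ⟨-, hmax⟩
    refine ⟨hM, fun N hN => ?_⟩
    obtain ⟨n', hn', hr⟩ := hN.exists_represents
    have := hmax n' hn'
    rw [key n M h hM, key n' N hr hN] at this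
    omega

theorem allowedGraph_adj_iff [Finite V] {G : SimpleGraph V} {u v : V} :
    (allowedGraph G).Adj u v ↔ ∃ n, MaxMat G n ∧ n u = v ∧ u ≠ v := by
  constructor
  · rintro ⟨M, hM, hadj⟩
    obtain ⟨n, hn, hr⟩ := hM.1.exists_represents
    exact ⟨n, (hr.isMaximumMatching_iff hM.1 hn).1 hM, (hr u v).1 hadj⟩
  · rintro ⟨n, hn, h⟩
    exact ⟨_, (hn.1.represents.isMaximumMatching_iff hn.1.toSubgraph_isMatching hn.1).2 hn, h⟩

theorem MaxMat.of_support_subset [Finite V] {G : SimpleGraph V} {m n : V → V} (hm : MaxMat G m)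
    (hn : IsMat G n) (h : ∀ v, m v ≠ v → n v ≠ v) : MaxMat G n :=
  ⟨hn, fun n' hn' => (hm.2 n' hn').trans (Set.ncard_le_ncard h (Set.toFinite _))⟩

theorem MaxMat.support_eq [Finite V] {G : SimpleGraph V} {m n : V → V} (hm : MaxMat G m)
    (hn : IsMat G n) (h : ∀ v, m v ≠ v → n v ≠ v) (v : V) : n v ≠ v ↔ m v ≠ v := by
  have := Set.eq_of_subset_of_ncard_le (s := {v | m v ≠ v}) (t := {v | n v ≠ v}) h (hm.2 n hn)
    (Set.toFinite _)
  exact (Set.ext_iff.1 this v).symm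

/-! ### Separating sets as sets closed under allowed edges -/

/-- No allowed edge leaves `X`. -/
def Closed (G : SimpleGraph V) (X : Set V) : Prop :=
  ∀ u ∈ X, ∀ v, (allowedGraph G).Adj u v → v ∈ X

/-- The vertex set of the factor-component of `v`. -/
def comp (G : SimpleGraph V) (v : V) : Set V := {w | (allowedGraph G).Reachable v w}

section Closed

variable {G : SimpleGraph V} {X Y : Set V}

theorem Closed.reachable (hX : Closed G X) {u v : V} (hu : u ∈ X)
    (h : (allowedGraph G).Reachable u v) : v ∈ X := by
  obtain ⟨p⟩ := h
  induction p with
  | nil => exact hu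
  | cons hadj _ ih => exact ih (hX _ hu _ hadj)

theorem mem_comp_self (v : V) : v ∈ comp G v := SimpleGraph.Reachable.refl v

theorem closed_comp (v : V) : Closed G (comp G v) := fun _ hu _ hadj =>
  SimpleGraph.Reachable.trans hu hadj.reachable

theorem Closed.comp_subset (hX : Closed G X) {v : V} (hv : v ∈ X) : comp G v ⊆ X :=
  fun _ hw => hX.reachable hv hw

theorem comp_eq_of_mem {u v : V} (h : u ∈ comp G v) : comp G u = comp G v := by
  ext w
  exact ⟨fun hw => SimpleGraph.Reachable.trans h hw,
    fun hw => SimpleGraph.Reachable.trans (SimpleGraph.Reachable.symm h) hw⟩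

theorem Closed.mem_of_mem_comp (hX : Closed G X) {u v : V} (hu : u ∈ X) (h : u ∈ comp G v) :
    v ∈ X := hX.reachable hu (SimpleGraph.Reachable.symm h)

theorem Closed.union (hX : Closed G X) (hY : Closed G Y) : Closed G (X ∪ Y) := by
  rintro u (hu | hu) v h
  · exact .inl (hX u hu v h)
  · exact .inr (hY u hu v h)

theorem Closed.involution_mem [Finite V] (hX : Closed G X) {m : V → V} (hm : MaxMat G m) {v : V}
    (hv : v ∈ X) : m v ∈ X := by
  by_cases h : m v = v
  · rwa [h]
  · exact hX v hv _ (allowedGraph_adj_iff.2 ⟨m, hm, rfl, fun h' => h h'.symm⟩)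

theorem mem_factorComponents_iff {H : G.Subgraph} :
    H ∈ factorComponents G ↔ ∃ v, H = (⊤ : G.Subgraph).induce (comp G v) := by
  have key : ∀ v, ((allowedGraph G).connectedComponentMk v).supp = comp G v := by
    intro v
    ext w
    simp only [SimpleGraph.ConnectedComponent.mem_supp_iff, SimpleGraph.ConnectedComponent.eq]
    exact ⟨SimpleGraph.Reachable.symm, SimpleGraph.Reachable.symm⟩
  constructor
  · rintro ⟨C, rfl⟩
    induction C using SimpleGraph.ConnectedComponent.ind with
    | _ v => exact ⟨v, by rw [key]⟩
  · rintro ⟨v, rfl⟩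
    exact ⟨_, by rw [key]⟩

theorem isSeparating_iff : IsSeparating G X ↔ X.Nonempty ∧ Closed G X := by
  constructor
  · rintro ⟨S, hS, ⟨H, hH⟩, rfl⟩
    refine ⟨?_, ?_⟩
    · obtain ⟨v, rfl⟩ := mem_factorComponents_iff.1 (hS hH)
      exact ⟨v, Set.mem_biUnion hH (mem_comp_self v)⟩
    · intro u hu v hadj
      simp only [Set.mem_iUnion] at hu ⊢
      obtain ⟨H, hH, hu⟩ := hu
      refine ⟨H, hH, ?_⟩
      obtain ⟨w, rfl⟩ := mem_factorComponents_iff.1 (hS hH)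
      exact closed_comp w u hu v hadj
  · rintro ⟨⟨x, hx⟩, hX⟩
    refine ⟨{H | ∃ v ∈ X, H = (⊤ : G.Subgraph).induce (comp G v)}, ?_, ⟨_, x, hx, rfl⟩, ?_⟩
    · rintro H ⟨v, -, rfl⟩
      exact mem_factorComponents_iff.2 ⟨v, rfl⟩
    · ext v
      simp only [Set.mem_iUnion]
      constructor
      · intro hv
        exact ⟨_, ⟨v, hv, rfl⟩, mem_comp_self v⟩
      · rintro ⟨H, ⟨w, hw, rfl⟩, hv⟩
        exact hX.comp_subset hw hv

end Closed

/-! ### Factor-criticality of the contraction in terms of alternating paths -/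

section Contract

variable {G : SimpleGraph V}

/-- The vertex `p` of `G[X] / H` corresponds to the vertex `u` of `G`, where the contracted vertex
corresponds to the vertex `h` of `H`. -/
def Lifts {X : Set V} {S : Set X} (h : V) : Option {v : X // v ∉ S} → V → Prop
  | none, u => u = h
  | some v, u => u = v.1.1

theorem Lifts.eq_right {X : Set V} {S : Set X} {h u v : V} {p : Option {v : X // v ∉ S}}
    (h1 : Lifts h p u) (h2 : Lifts h p v) : u = v := by
  cases p <;> exact Eq.trans h1 (Eq.symm h2)

theorem Lifts.eq_left {X Hs : Set V} {h u : V} (hh : h ∈ Hs)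
    {p q : Option {v : X // v ∉ {v : X | (v : V) ∈ Hs}}}
    (h1 : Lifts h p u) (h2 : Lifts h q u) : p = q := by
  rcases p with _ | ⟨⟨p, hp⟩, hp'⟩ <;> rcases q with _ | ⟨⟨q, hq⟩, hq'⟩ <;>
    simp only [Lifts] at h1 h2
  · rfl
  · exact (hq' (show q ∈ Hs by rwa [← h2, h1])).elim
  · exact (hp' (show p ∈ Hs by rwa [← h1, h2])).elim
  · obtain rfl : p = q := h1.symm.trans h2
    rfl

/-- A matching of the contraction has at most one edge at the contracted vertex, so a single vertex
`h` of `Hs` can represent it. -/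
theorem exists_contract_matching {X Hs : Set V} (hHX : Hs ⊆ X) {h : V} (hh : h ∈ Hs) {n : V → V}
    (hn : IsMat G n) (hsupp : ∀ v, n v ≠ v → v ∈ X \ Hs ∨ v = h) :
    ∃ N : (contract (G.induce X) {v : X | (v : V) ∈ Hs}).Subgraph, N.IsMatching ∧
      ∀ p, p ∈ N.verts ↔ ∃ u, Lifts h p u ∧ n u ≠ u := by
  have hlift : ∀ v, n v ≠ v → ∃ p : Option {v : X // v ∉ {v : X | (v : V) ∈ Hs}}, Lifts h p v := by
    intro v hv
    rcases hsupp v hv with hv | rfl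
    · exact ⟨some ⟨⟨v, hv.1⟩, hv.2⟩, rfl⟩
    · exact ⟨none, rfl⟩
  let N : (contract (G.induce X) {v : X | (v : V) ∈ Hs}).Subgraph :=
    { verts := {p | ∃ u, Lifts h p u ∧ n u ≠ u}
      Adj := fun p q => ∃ u, Lifts h p u ∧ Lifts h q (n u) ∧ n u ≠ u
      adj_sub := by
        rintro (_ | ⟨⟨p, hp⟩, hp'⟩) (_ | ⟨⟨q, hq⟩, hq'⟩) ⟨u, h1, h2, h3⟩
        · exact (h3 (Eq.trans h2 (Eq.symm h1))).elim
        · have h4 := hn.2 u h3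
          simp only [Lifts] at h1 h2
          rw [h2, h1] at h4
          exact ⟨⟨h, hHX hh⟩, hh, h4⟩
        · have h4 := hn.2 u h3
          simp only [Lifts] at h1 h2
          rw [h2, h1] at h4
          exact ⟨⟨h, hHX hh⟩, hh, h4.symm⟩
        · have h4 := hn.2 u h3
          simp only [Lifts] at h1 h2
          rw [h2, h1] at h4
          exact h4
      edge_vert := by
        rintro p q ⟨u, h1, h2, h3⟩
        exact ⟨u, h1, h3⟩
      symm := ⟨by
        rintro p q ⟨u, h1, h2, h3⟩
        exact ⟨n u, h2, by rwa [hn.1], by rw [hn.1]; exact h3.symm⟩⟩ }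
  refine ⟨N, ?_, fun p => Iff.rfl⟩
  rintro p ⟨u, h1, h2⟩
  obtain ⟨q, hq⟩ := hlift (n u) (by rw [hn.1]; exact h2.symm)
  refine ⟨q, ⟨u, h1, hq, h2⟩, ?_⟩
  rintro r ⟨u', h3, h4, h5⟩
  obtain rfl := h1.eq_right h3
  exact h4.eq_left hh hq

theorem exists_isMat_of_contract {X Hs : Set V} (hne : Hs.Nonempty)
    (N : (contract (G.induce X) {v : X | (v : V) ∈ Hs}).Subgraph) (hN : N.IsMatching) :
    ∃ n h, IsMat G n ∧ h ∈ Hs ∧ ∀ u, n u ≠ u ↔ ∃ p ∈ N.verts, Lifts h p u := by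
  -- The representative is the end in `Hs` of an edge inducing the matching edge at the contracted
  -- vertex, and arbitrary if there is none.
  obtain ⟨h, hh, hadj⟩ : ∃ h ∈ Hs, ∀ v, N.Adj none (some v) → G.Adj h v.1.1 := by
    by_cases hex : ∃ v, N.Adj none (some v)
    · obtain ⟨v, hv⟩ := hex
      obtain ⟨u, hu, huv⟩ := hv.adj_sub
      refine ⟨u, hu, fun w hw => ?_⟩
      have := hN.eq_of_adj_left hv hw
      cases this
      exact huv
    · push Not at hex
      exact ⟨_, hne.some_mem, fun v hv => (hex v hv).elim⟩
  obtain ⟨n, hn, hr⟩ := exists_isMat_of_rel (G := G)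
    (fun u v => ∃ p q, Lifts h p u ∧ Lifts h q v ∧ N.Adj p q)
    (by rintro u v ⟨p, q, h1, h2, h3⟩; exact ⟨q, p, h2, h1, h3.symm⟩)
    (by
      rintro u v w ⟨p, q, h1, h2, h3⟩ ⟨p', q', h1', h2', h3'⟩
      obtain rfl := h1.eq_left hh h1'
      obtain rfl := hN.eq_of_adj_left h3 h3'
      exact h2.eq_right h2')
    (by
      rintro u v ⟨_ | p, _ | q, h1, h2, h3⟩
      · exact (h3.adj_sub).elim
      · simp only [Lifts] at h1 h2; subst h1; subst h2
        exact hadj q h3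
      · simp only [Lifts] at h1 h2; subst h1; subst h2
        exact (hadj p h3.symm).symm
      · simp only [Lifts] at h1 h2; subst h1; subst h2
        exact h3.adj_sub)
  refine ⟨n, h, hn, hh, fun u => ?_⟩
  constructor
  · intro hu
    obtain ⟨p, q, h1, h2, h3⟩ := (hr u (n u)).2 ⟨rfl, hu.symm⟩
    exact ⟨p, h3.fst_mem, h1⟩
  · rintro ⟨p, hp, h1⟩
    obtain ⟨q, hq, -⟩ := hN hp
    obtain ⟨v, hv⟩ : ∃ v, Lifts h q v := by
      rcases q with _ | q
      · exact ⟨h, rfl⟩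
      · exact ⟨q.1.1, rfl⟩
    obtain ⟨rfl, h'⟩ := (hr u v).1 ⟨p, q, h1, hv, hq⟩
    exact h'.symm

/-- Every vertex of `X` is joined to `Hs` by an even alternating path inside `X`. -/
def Crit (G : SimpleGraph V) (m : V → V) (Hs X : Set V) : Prop :=
  Hs ⊆ X ∧ ∀ z ∈ X, ∃ L h, EvenPath G m z L h ∧ DisjointPairs m L ∧ h ∈ Hs ∧ ∀ a ∈ L, a ∈ X \ Hs

theorem crit_self (m : V → V) (Hs : Set V) : Crit G m Hs Hs :=
  ⟨subset_rfl, fun z hz => ⟨[], z, rfl, by simp [DisjointPairs], hz, by simp⟩⟩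

theorem Crit.ne {m : V → V} {Hs X : Set V} (h : Crit G m Hs X) {z : V} (hz : z ∈ X \ Hs) :
    m z ≠ z := by
  obtain ⟨L, h, hL, hd, hh, -⟩ := h.2 z hz.1
  cases L with
  | nil => obtain rfl : z = h := hL; exact (hz.2 hh).elim
  | cons x L =>
    obtain ⟨rfl, -⟩ := hL
    exact hd.2 z (by simp)

theorem Crit.isFactorCritical {m : V → V} (hm : IsMat G m) {Hs X : Set V} (hne : Hs.Nonempty)
    (hmS : ∀ v ∈ X \ Hs, m v ∈ X \ Hs) (h : Crit G m Hs X) :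
    IsFactorCritical (contract (G.induce X) {v : X | (v : V) ∈ Hs}) := by
  classical
  rintro (_ | ⟨⟨z, hzX⟩, hzH⟩)
  · obtain ⟨h₀, hh₀⟩ := hne
    have hgl := hm.glue (m := id) isMat_id hmS (fun v hv => hv)
    obtain ⟨N, hN, hv⟩ := exists_contract_matching h.1 hh₀ hgl (by
      intro v hv; left; by_contra hc; simp [glue, hc] at hv)
    refine ⟨N, hN, ?_⟩
    ext p
    rw [hv]
    rcases p with _ | ⟨⟨p, hp⟩, hp'⟩
    · simp [Lifts, glue, hh₀]
    · have : m p ≠ p := h.ne ⟨hp, hp'⟩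
      have hp'' : p ∉ Hs := hp'
      simp [Lifts, glue, hp, hp'', this]
  · have hz : z ∈ X \ Hs := ⟨hzX, hzH⟩
    obtain ⟨L, h₀, hL, hd, hh₀, hLX⟩ := h.2 z hzX
    rcases L.eq_nil_or_concat' with rfl | ⟨L, y, rfl⟩
    · obtain rfl : z = h₀ := hL
      exact (hzH hh₀).elim
    obtain ⟨c, hL', rfl, w, hadj, hw⟩ := evenPath_append.1 hL
    obtain rfl : w = h₀ := hw
    obtain ⟨n, hn, hnz, hny, hoff, hon⟩ := exists_switch hm hL' hd
    have hcS : c ∈ X \ Hs := hLX c (by simp)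
    have hprs : ∀ v, v ∈ L ++ [c] ∨ m v ∈ L ++ [c] → v ∈ X \ Hs := by
      rintro v (hv | hv)
      · exact hLX v hv
      · rw [← hm.1 v]; exact hmS _ (hLX _ hv)
    have hnS : ∀ v ∈ X \ Hs, n v ∈ X \ Hs := by
      intro v hv
      by_cases hvp : v ∈ L ++ [c] ∨ m v ∈ L ++ [c]
      · exact hprs _ (hon v hvp).1
      · push Not at hvp
        rw [hoff v hvp.1 hvp.2]; exact hmS v hv
    have hnf : ∀ v ∈ X \ Hs, v ≠ z → v ≠ m c → n v ≠ v := by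
      intro v hv
      by_cases hvp : v ∈ L ++ [c] ∨ m v ∈ L ++ [c]
      · exact (hon v hvp).2
      · push Not at hvp
        rw [hoff v hvp.1 hvp.2]
        intro _ _
        exact h.ne hv
    have hmc := hmS c hcS
    have hmcz : m c ≠ z := hL'.partner_last_ne hm.1 hd
    have hwS : w ∉ X \ Hs := fun h => h.2 hh₀
    have hgl := hn.glue (m := id) isMat_id hnS (fun v hv => hv)
    -- The exchange exposes `z` and `m c`. The last edge of the path covers `m c` again, with `w`
    -- standing for the contracted vertex, so only `z` stays exposed.
    have hjoin := hgl.join (p := m c) (q := w) (by simp [glue, hny]) (by simp [glue, hwS]) hadj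
    obtain ⟨N, hN, hv⟩ := exists_contract_matching h.1 hh₀ hjoin (by
      intro v hv
      by_contra hc
      push Not at hc
      have hvc : v ≠ m c := fun h => hc.1 (h ▸ hmc)
      apply hv
      simp only [join, glue, hvc, hc.1, hc.2, if_false, id])
    refine ⟨N, hN, ?_⟩
    ext p
    rw [hv]
    rcases p with _ | ⟨⟨p, hp⟩, hp'⟩
    · have : m c ≠ w := fun h => hwS (h ▸ hmc)
      simp only [Lifts, exists_eq_left, join]
      simp [this.symm, this]
    · have hpS : p ∈ X \ Hs := ⟨hp, hp'⟩
      have := hnf p hpS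
      simp only [Lifts, exists_eq_left]
      simp only [Set.mem_compl_iff, Set.mem_singleton_iff, Option.some.injEq, Subtype.mk.injEq]
      unfold join glue
      grind

/-- For a vertex `z` outside `Hs`, compare `m` with a matching of the contraction missing only `z`:
their symmetric difference contains an alternating path from `z` to the contracted vertex. -/
theorem crit_of_isFactorCritical [Finite V] {m : V → V} (hm : MaxMat G m) {Hs X : Set V}
    (hne : Hs.Nonempty) (hHX : Hs ⊆ X) (hmS : ∀ v ∈ X \ Hs, m v ∈ X \ Hs)
    (h : IsFactorCritical (contract (G.induce X) {v : X | (v : V) ∈ Hs})) : Crit G m Hs X := by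
  -- The matching missing the contracted vertex is perfect on `X \ Hs`. Glued to `m` elsewhere it
  -- covers all that `m` covers, so by maximality `m` covers `X \ Hs` too.
  have hfix : ∀ v ∈ X \ Hs, m v ≠ v := by
    obtain ⟨N, hN, hv⟩ := h none
    obtain ⟨n, h₀, hn, hh₀, hsupp⟩ := exists_isMat_of_contract hne N hN
    have hsupp' : ∀ u, n u ≠ u ↔ u ∈ X \ Hs := by
      intro u
      rw [hsupp, hv]
      constructor
      · rintro ⟨_ | p, hp, hl⟩
        · simp at hp
        · simp only [Lifts] at hl
          subst hl
          exact ⟨p.1.2, p.2⟩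
      · intro hu
        exact ⟨some ⟨⟨u, hu.1⟩, hu.2⟩, by simp, rfl⟩
    have hnS : ∀ v ∈ X \ Hs, n v ∈ X \ Hs := by
      intro v hv
      rw [← hsupp', hn.1]
      exact ((hsupp' v).2 hv).symm
    have hg := hn.glue hm.1 hnS hmS
    have := hm.support_eq hg (fun v hv => by
      by_cases hvS : v ∈ X \ Hs
      · simpa [glue, hvS] using (hsupp' v).2 hvS
      · simpa only [glue, hvS, if_false] using hv)
    intro v hv
    rw [← this]
    simpa only [glue, hv, if_true] using (hsupp' v).2 hv
  refine ⟨hHX, fun z hzX => ?_⟩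
  by_cases hzH : z ∈ Hs
  · exact ⟨[], z, rfl, by simp [DisjointPairs], hzH, by simp⟩
  have hz : z ∈ X \ Hs := ⟨hzX, hzH⟩
  obtain ⟨N, hN, hv⟩ := h (some ⟨⟨z, hzX⟩, hzH⟩)
  obtain ⟨n, h₀, hn, hh₀, hsupp⟩ := exists_isMat_of_contract hne N hN
  have hsupp' : ∀ u, n u ≠ u ↔ u = h₀ ∨ u ∈ X \ Hs ∧ u ≠ z := by
    intro u
    rw [hsupp, hv]
    constructor
    · rintro ⟨_ | p, hp, hl⟩
      · exact .inl hl
      · simp only [Lifts] at hl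
        subst hl
        refine .inr ⟨⟨p.1.2, p.2⟩, ?_⟩
        rintro rfl
        exact hp rfl
    · rintro (rfl | ⟨hu, hne⟩)
      · exact ⟨none, by simp, rfl⟩
      · exact ⟨some ⟨⟨u, hu.1⟩, hu.2⟩, by simpa using hne, rfl⟩
  have hnz : n z = z := by
    by_contra hc
    rcases (hsupp' z).1 hc with rfl | h
    · exact hzH hh₀
    · exact h.2 rfl
  obtain ⟨L, y, hL, hd, hLS, hend⟩ := exists_alternating_path hm.1 hn (Y := (X \ Hs)ᶜ)
    (by simpa only [Set.mem_compl_iff, not_not] using hmS)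
    (by simpa only [Set.mem_compl_iff, not_not] using hfix) (by simpa using hz) hnz
  simp only [Set.mem_compl_iff, not_not] at hLS hend
  have hyS := (hLS y (by simp)).1
  rcases hend with hend | ⟨e, heS, hne', hadj⟩
  -- The path cannot stop inside `X \ Hs`, because `z` is the only vertex there that `n` misses.
  · exact ((hsupp' _).2 (.inr ⟨hmS y hyS, hL.partner_last_ne hm.1.1 hd⟩) hend).elim
  · have he : n e ≠ e := fun h => heS (h ▸ hne')
    rcases (hsupp' e).1 he with rfl | h
    · exact ⟨L ++ [y], e, evenPath_append.2 ⟨y, hL, rfl, e, hadj, rfl⟩, hd, hh₀,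
        fun a ha => (hLS a ha).1⟩
    · exact (heS h.1).elim

theorem Closed.involution_mem_diff [Finite V] {Hs X : Set V} (hX : Closed G X)
    (hH : Closed G Hs) {m : V → V} (hm : MaxMat G m) : ∀ v ∈ X \ Hs, m v ∈ X \ Hs := by
  intro v hv
  refine ⟨hX.involution_mem hm hv.1, fun h => hv.2 ?_⟩
  rw [← hm.1.1 v]
  exact hH.involution_mem hm h

/-- The left side does not mention `m`, so the path condition holds for all maximum matchings as
soon as it holds for one. -/
theorem isCriticalInducing_iff [Finite V] {m : V → V} (hm : MaxMat G m) {H : G.Subgraph}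
    (hH : H ∈ factorComponents G) {X : Set V} :
    IsCriticalInducing G H X ↔ Closed G X ∧ Crit G m H.verts X := by
  obtain ⟨v, rfl⟩ := mem_factorComponents_iff.1 hH
  have hne : (comp G v).Nonempty := ⟨v, mem_comp_self v⟩
  constructor
  · rintro ⟨h1, h2, h3⟩
    have hX := (isSeparating_iff.1 h1).2
    exact ⟨hX, crit_of_isFactorCritical hm hne h2 (hX.involution_mem_diff (closed_comp v) hm) h3⟩
  · rintro ⟨hX, h⟩
    exact ⟨isSeparating_iff.2 ⟨hne.mono h.1, hX⟩, h.1,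
      h.isFactorCritical hm.1 hne (hX.involution_mem_diff (closed_comp v) hm)⟩

end Contract

/-! ### Enlarging critical-inducing sets -/

variable {G : SimpleGraph V} {m : V → V}

theorem DisjointPairs.perm (hm : ∀ v, m (m v) = v) {L L' : List V} (h : DisjointPairs m L)
    (hp : L.Perm L') : DisjointPairs m L' := by
  refine ⟨hp.pairwise h.1 ?_, fun a ha => h.2 a (hp.mem_iff.2 ha)⟩
  rintro a b ⟨h1, h2⟩
  exact ⟨h1.symm, fun h => h2 (by rw [h, hm])⟩

/-- A set stable under the matching separates the pairs of the two lists. Concatenated paths are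
shown to be disjoint mostly in this way, after truncation at the set. -/
theorem DisjointPairs.append_of_mem {L₁ L₂ : List V} (h₁ : DisjointPairs m L₁)
    (h₂ : DisjointPairs m L₂) {Y : Set V} (hY : ∀ v, m v ∈ Y → v ∈ Y) (hL₁ : ∀ a ∈ L₁, a ∉ Y)
    (hL₂ : ∀ a ∈ L₂, a ∈ Y) : DisjointPairs m (L₁ ++ L₂) := by
  refine disjointPairs_append.2 ⟨h₁, h₂, fun a ha b hb => ⟨?_, ?_⟩⟩
  · rintro rfl; exact hL₁ _ ha (hL₂ _ hb)
  · rintro rfl; exact hL₁ _ ha (hY _ (hL₂ _ hb))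

/-- The vertices of the pairs `{y, m y}` for `y` in `L`. -/
def pairs (m : V → V) (L : List V) : Set V := {v | v ∈ L ∨ m v ∈ L}

theorem mem_pairs_of_partner (hm : ∀ v, m (m v) = v) {L : List V} (v : V) (h : m v ∈ pairs m L) :
    v ∈ pairs m L := by
  rcases h with h | h
  · exact .inr h
  · rw [hm] at h; exact .inl h

theorem Closed.mem_of_involution_mem [Finite V] {X : Set V} (hX : Closed G X) (hm : MaxMat G m)
    (v : V) (h : m v ∈ X) : v ∈ X := by
  rw [← hm.1.1 v]; exact hX.involution_mem hm h

/-- From a vertex of a list ear, one can follow the ear to one of its ends. -/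
theorem ListEar.exists_evenPath (hm : ∀ v, m (m v) = v) {a b d : V} {E : List V}
    (hE : ListEar G m a E b) (hd : DisjointPairs m E) (hdE : d ∈ pairs m E) :
    ∃ Q g, EvenPath G m d Q g ∧ DisjointPairs m Q ∧ (g = a ∨ g = b) ∧ ∀ q ∈ Q, q ∈ pairs m E := by
  rcases hdE with h | h
  · obtain ⟨A, B, rfl⟩ := List.append_of_mem h
    exact ⟨d :: B, b, evenPath_cons.2 ⟨rfl, (listEar_append_cons.1 hE).2⟩,
      (disjointPairs_append.1 hd).2.1, .inr rfl, fun q hq => .inl (by simp_all)⟩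
  · obtain ⟨A, B, rfl⟩ := List.append_of_mem h
    refine ⟨d :: A.reverse.map m, a,
      evenPath_cons.2 ⟨rfl, (listEar_append_cons.1 hE).1.reverse hm⟩, ?_, .inl rfl, ?_⟩
    · rw [List.append_cons] at hd
      have := (disjointPairs_append.1 hd).1.reverse hm
      simpa [hm] using this
    · intro q hq
      right
      rw [List.mem_cons, mem_reverse_map hm] at hq
      rcases hq with rfl | hq <;> simp_all

/-- If `x` and `n x` are joined by an edge of the matching `n`, both matchings being perfect on
`K`, then some closed alternating path passes through this edge. -/
theorem exists_cycle [Finite V] {n : V → V} (hm : IsMat G m) (hn : IsMat G n) {K : Set V}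
    (hmK : ∀ v ∈ K, m v ∈ K) (hnK : ∀ v ∈ K, n v ∈ K) (hmf : ∀ v ∈ K, m v ≠ v)
    (hnf : ∀ v ∈ K, n v ≠ v) {x : V} (hx : x ∈ K) :
    ∃ C, EvenPath G m (n x) C (n x) ∧ DisjointPairs m C ∧ (∀ a ∈ C, a ∈ K) ∧ m x ∈ C := by
  -- Without the edge between `x` and `n x`, the second matching exposes only these two vertices of
  -- `K`. The path from `n x` therefore ends at `x`, and the removed edge closes it.
  obtain ⟨L, y, hL, hd, hLK, hend⟩ := exists_alternating_path hm (hn.cut x) (Y := Kᶜ)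
    (by simpa only [Set.mem_compl_iff, not_not] using hmK)
    (by simpa only [Set.mem_compl_iff, not_not] using hmf) (z := n x)
    (by simpa using hnK x hx) (by simp [cut])
  simp only [Set.mem_compl_iff, not_not] at hLK hend
  have hyK := (hLK y (by simp)).1
  have hne := hL.partner_last_ne hm.1 hd
  have hmy : m y = x := by
    rcases hend with hend | ⟨e, he, hne', -⟩
    · have := hnf _ (hmK y hyK)
      unfold cut at hend
      grind
    · have := hnK (n e)
      have := hn.1 e
      unfold cut at hne'
      grind
  refine ⟨L ++ [y], evenPath_append.2 ⟨y, hL, rfl, n x, ?_, rfl⟩, hd, fun a ha => (hLK a ha).1, ?_⟩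
  · rw [hmy]; exact hn.2 x (hnf x hx)
  · simp [← hmy, hm.1]

/-- In a factor-component covered by all maximum matchings, an alternating path starting with a
matching edge leads from each vertex to each matching edge. -/
theorem exists_evenPath_comp [Finite V] (hm : MaxMat G m) {z y : V}
    (hcons : ∀ n, MaxMat G n → ∀ v ∈ comp G z, n v ≠ v) (hy : y ∈ comp G z) :
    ∃ L c, EvenPath G m z L c ∧ DisjointPairs m (L ++ [c]) ∧ (∀ a ∈ L ++ [c], a ∈ comp G z) ∧
      (c = y ∨ c = m y) := by
  have h1 := hm.1.1
  have hK := closed_comp (G := G) z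
  -- It suffices that reachability passes along allowed edges, since these connect the
  -- factor-component.
  have hclosed : Closed G {y | ∃ L c, EvenPath G m z L c ∧ DisjointPairs m (L ++ [c]) ∧
      (∀ a ∈ L ++ [c], a ∈ comp G z) ∧ (c = y ∨ c = m y)} := by
    rintro x ⟨L, c, hL, hd, hLK, hc⟩ w hxw
    obtain ⟨n, hn, rfl, -⟩ := allowedGraph_adj_iff.1 hxw
    have hcK := hLK c (by simp)
    have hxK : x ∈ comp G z := by
      rcases hc with rfl | rfl
      · exact hcK
      · exact hK.mem_of_involution_mem hm _ hcK
    obtain ⟨C, hC, hCd, hCK, hxC⟩ := exists_cycle hm.1 hn.1 (fun v => hK.involution_mem hm)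
      (fun v => hK.involution_mem hn) (hcons m hm) (hcons n hn) hxK
    have hcC : c ∈ pairs m C := by
      rcases hc with rfl | rfl
      · exact .inr hxC
      · exact .inl hxC
    -- Stop where the path first meets the alternating circuit through the allowed edge, then follow
    -- the circuit in the direction of the matching edge at `d` to the pair of `n x`.
    obtain ⟨L₁, L₂, d, rfl, hL₁, -, hdC, -, hL₁C⟩ := hL.truncate hcC
    have hd₁ : DisjointPairs m L₁ := (disjointPairs_append.1 (disjointPairs_append.1 hd).1).1
    have hCK' : ∀ a ∈ pairs m C, a ∈ comp G z := by
      rintro a (ha | ha)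
      · exact hCK a ha
      · exact hK.mem_of_involution_mem hm _ (hCK _ ha)
    have key : ∀ Q e, EvenPath G m d Q e → DisjointPairs m (Q ++ [e]) →
        (∀ q ∈ Q ++ [e], q ∈ pairs m C) → (e = n x ∨ e = m (n x)) →
        ∃ L c, EvenPath G m z L c ∧ DisjointPairs m (L ++ [c]) ∧
          (∀ a ∈ L ++ [c], a ∈ comp G z) ∧ (c = n x ∨ c = m (n x)) := by
      intro Q e hQ hQd hQC he
      refine ⟨L₁ ++ Q, e, evenPath_append.2 ⟨d, hL₁, hQ⟩, ?_, ?_, he⟩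
      · rw [List.append_assoc]
        exact hd₁.append_of_mem hQd (mem_pairs_of_partner h1) hL₁C hQC
      · intro a ha
        rw [List.append_assoc, List.mem_append] at ha
        rcases ha with ha | ha
        · exact hLK a (by simp [ha])
        · exact hCK' a (hQC a ha)
    have hfd : m d ≠ d := hcons m hm d (hCK' d hdC)
    rcases hdC with h | h
    · obtain ⟨A, B, rfl⟩ := List.append_of_mem h
      obtain ⟨d', hA, hB⟩ := evenPath_append.1 hC
      obtain rfl := (evenPath_cons.1 hB).1
      cases A with
      | nil =>
        obtain rfl : n x = d' := hA
        exact key [] _ rfl (by simpa [DisjointPairs] using hfd) (by simp [pairs]) (.inl rfl)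
      | cons a A =>
        obtain ⟨rfl, -⟩ := hA
        -- Rotating the circuit list moves its first vertex `n x` to the end, where it closes the
        -- segment starting at `d'`.
        refine key _ _ hB (hCd.perm h1 ?_ |> fun h => (disjointPairs_append (L₁ := A).1 h).2.1) ?_
          (.inl rfl)
        · rw [List.cons_append, ← List.append_assoc]
          exact (List.perm_append_singleton _ _).symm
        · intro q hq
          left
          simp at hq ⊢; tauto
    · obtain ⟨A, B, rfl⟩ := List.append_of_mem h
      obtain ⟨d', hA, hB⟩ := evenPath_append.1 hC
      obtain rfl := (evenPath_cons.1 hB).1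
      cases A with
      | nil =>
        obtain hA : n x = m d := hA
        exact key [] d rfl (by simpa [DisjointPairs] using hfd) (by simp [pairs])
          (.inr (by rw [hA, h1]))
      | cons a A =>
        obtain ⟨rfl, hA⟩ := evenPath_cons.1 hA
        refine key (d :: A.reverse.map m) (m (n x)) (evenPath_cons.2 ⟨rfl, hA.reverse h1⟩) ?_ ?_
          (.inr rfl)
        · rw [List.append_cons] at hCd
          have := (disjointPairs_append.1 hCd).1.reverse h1
          simpa [h1] using this
        · intro q hq
          right
          rw [List.cons_append, List.mem_cons, List.mem_append, mem_reverse_map h1,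
            List.mem_singleton] at hq
          rcases hq with rfl | hq | rfl <;> simp_all
  refine hclosed.reachable (u := z) ⟨[], z, rfl, ?_, ?_, .inl rfl⟩ hy
  · simpa [DisjointPairs] using hcons m hm z (mem_comp_self z)
  · simpa using mem_comp_self z

/-- From a new vertex, move inside its factor-component until the ear is met, follow the ear in the
direction of the matching edge to an end in `U`, and continue by a path of `U`. The three segments
are separated by the pairs of the ear and by `U`. -/
theorem Crit.extend [Finite V] (hm : MaxMat G m) {Hs U : Set V} (hU : Closed G U)
    (h : Crit G m Hs U) {a b : V} {E : List V} (hE : ListEar G m a E b) (ha : a ∈ U) (hb : b ∈ U)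
    (hd : DisjointPairs m E) (hEU : ∀ e ∈ E, e ∉ U)
    (hcons : ∀ e ∈ E, ∀ n, MaxMat G n → ∀ v ∈ comp G e, n v ≠ v) :
    Crit G m Hs (U ∪ {v | ∃ e ∈ E, v ∈ comp G e}) := by
  refine ⟨h.1.trans Set.subset_union_left, ?_⟩
  rintro z (hz | ⟨e, he, hz⟩)
  · obtain ⟨L, g, hL, hLd, hg, hLU⟩ := h.2 z hz
    exact ⟨L, g, hL, hLd, hg, fun a ha => ⟨.inl (hLU a ha).1, (hLU a ha).2⟩⟩
  have hcomp := comp_eq_of_mem hz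
  obtain ⟨L, c, hL, hLd, hLK, hc⟩ := exists_evenPath_comp hm (z := z) (y := e)
    (by rw [hcomp]; exact hcons e he) (by rw [hcomp]; exact mem_comp_self e)
  have hcE : c ∈ pairs m E := by
    rcases hc with rfl | rfl
    · exact .inl he
    · exact .inr (by rwa [hm.1.1])
  obtain ⟨L₁, L₂, d, rfl, hL₁, -, hdE, -, hL₁E⟩ := hL.truncate hcE
  obtain ⟨Q, g, hQ, hQd, hg, hQE⟩ := hE.exists_evenPath hm.1.1 hd hdE
  have hgU : g ∈ U := by rcases hg with rfl | rfl <;> assumption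
  obtain ⟨L₃, g', hL₃, hL₃d, hg', hL₃U⟩ := h.2 g hgU
  have hL₁K : ∀ a ∈ L₁, a ∈ comp G e := fun a ha => by
    rw [← hcomp]; exact hLK a (by simp [ha])
  have hL₁U : ∀ a ∈ L₁, a ∉ U := fun a ha haU =>
    hEU e he (hU.mem_of_mem_comp haU (hL₁K a ha))
  have hQK : ∀ q ∈ Q, ∃ e ∈ E, q ∈ comp G e := by
    intro q hq
    rcases hQE q hq with h | h
    · exact ⟨q, h, mem_comp_self q⟩
    · exact ⟨_, h, (closed_comp _).mem_of_involution_mem hm _ (mem_comp_self _)⟩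
  have hQU : ∀ q ∈ Q, q ∉ U := by
    intro q hq hqU
    obtain ⟨e, he, hqe⟩ := hQK q hq
    exact hEU e he (hU.mem_of_mem_comp hqU hqe)
  refine ⟨L₁ ++ (Q ++ L₃), g', evenPath_append.2 ⟨d, hL₁, evenPath_append.2 ⟨g, hQ, hL₃⟩⟩, ?_, hg',
    ?_⟩
  · rw [← List.append_assoc]
    refine DisjointPairs.append_of_mem ?_ hL₃d (hU.mem_of_involution_mem hm) ?_
      (fun a ha => (hL₃U a ha).1)
    · exact (disjointPairs_append.1 (disjointPairs_append.1 hLd).1).1.append_of_mem hQd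
        (mem_pairs_of_partner hm.1.1) hL₁E hQE
    · intro a ha
      rcases List.mem_append.1 ha with ha | ha
      · exact hL₁U a ha
      · exact hQU a ha
  · intro a ha
    rw [List.mem_append, List.mem_append] at ha
    rcases ha with ha | ha | ha
    · exact ⟨.inr ⟨e, he, hL₁K a ha⟩, fun h' => hL₁U a ha (h.1 h')⟩
    · exact ⟨.inr (hQK a ha), fun h' => hQU a ha (h.1 h')⟩
    · exact ⟨.inl (hL₃U a ha).1, (hL₃U a ha).2⟩

/-- A path in `X₂` towards `H₂` is cut where it enters `X₁` and continued by a path in `X₁`. This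
gives transitivity of the order. -/
theorem Crit.trans [Finite V] (hm : MaxMat G m) {H₁ H₂ X₁ X₂ : Set V} (hX₁ : Closed G X₁)
    (h₁ : Crit G m H₁ X₁) (h₂ : Crit G m H₂ X₂) (h : H₂ ⊆ X₁) : Crit G m H₁ (X₁ ∪ X₂) := by
  refine ⟨h₁.1.trans Set.subset_union_left, ?_⟩
  have key : ∀ z ∈ X₁ ∪ X₂, ∃ L c, EvenPath G m z L c ∧ DisjointPairs m L ∧ c ∈ X₁ ∧
      ∀ a ∈ L, a ∈ X₂ \ X₁ := by
    rintro z (hz | hz)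
    · exact ⟨[], z, rfl, by simp [DisjointPairs], hz, by simp⟩
    · obtain ⟨L, g, hL, hLd, hg, hLX⟩ := h₂.2 z hz
      obtain ⟨L₁, L₂, d, rfl, hL₁, -, hd, -, hL₁X⟩ := hL.truncate (h hg)
      exact ⟨L₁, d, hL₁, (disjointPairs_append.1 hLd).1, hd,
        fun a ha => ⟨(hLX a (by simp [ha])).1, hL₁X a ha⟩⟩
  intro z hz
  obtain ⟨L, c, hL, hLd, hc, hLX⟩ := key z hz
  obtain ⟨L', g, hL', hLd', hg, hLX'⟩ := h₁.2 c hc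
  refine ⟨L ++ L', g, evenPath_append.2 ⟨c, hL, hL'⟩, hLd.append_of_mem hLd'
    (hX₁.mem_of_involution_mem hm) (fun a ha => (hLX a ha).2) (fun a ha => (hLX' a ha).1), hg, ?_⟩
  intro a ha
  rcases List.mem_append.1 ha with ha | ha
  · exact ⟨.inr (hLX a ha).1, fun h => (hLX a ha).2 (h₁.1 h)⟩
  · exact ⟨.inl (hLX' a ha).1, (hLX' a ha).2⟩

/-! ### Prolonging ears -/

/-- Some list ear relative to `Hs` with internal vertices in `W` meets `K`. -/
def EarThrough (G : SimpleGraph V) (m : V → V) (Hs W K : Set V) : Prop :=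
  ∃ a b E, ListEar G m a E b ∧ DisjointPairs m E ∧ a ∈ Hs ∧ b ∈ Hs ∧ (∀ e ∈ E, e ∈ W \ Hs) ∧
    ∃ e ∈ E, e ∈ K

theorem ListEar.truncate {a b : V} {L : List V} (hL : ListEar G m a L b) {Y : Set V} (hb : b ∈ Y) :
    ∃ L₁ L₂ c, L = L₁ ++ L₂ ∧ ListEar G m a L₁ c ∧ c ∈ Y ∧ ∀ x ∈ L₁, x ∉ Y := by
  obtain ⟨w, hw, hL⟩ := hL
  obtain ⟨L₁, L₂, c, rfl, h1, -, hc, -, h2⟩ := hL.truncate hb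
  exact ⟨L₁, L₂, c, rfl, ⟨w, hw, h1⟩, hc, h2⟩

/-- The given alternating path may revisit `Hs`. Cutting it at the nearest visits to `Hs` on both
sides of `e` leaves a genuine ear through `e`. -/
theorem ListEar.earThrough [Finite V] (hm : MaxMat G m) {Hs W K : Set V} (hH : Closed G Hs)
    {a b e : V} {L : List V} (hL : ListEar G m a L b) (hd : DisjointPairs m L) (ha : a ∈ Hs)
    (hb : b ∈ Hs) (hW : ∀ x ∈ L, x ∈ W) (he : e ∈ L) (heH : e ∉ Hs)
    (heK : e ∈ K) :
    EarThrough G m Hs W K := by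
  have h1 := hm.1.1
  obtain ⟨A, B, rfl⟩ := List.append_of_mem he
  obtain ⟨hA, hB⟩ := listEar_append_cons.1 hL
  obtain ⟨B₁, B₂, b', rfl, hB₁, hb', hB₁H⟩ := hB.truncate hb
  obtain ⟨A₁, A₂, a', hAeq, hA₁, ha', hA₁H⟩ := (hA.reverse h1).truncate ha
  have hA₁' := hA₁.reverse h1
  have hA' : A = A₂.reverse.map m ++ A₁.reverse.map m := by
    rw [← reverse_map_reverse_map h1 A, hAeq, List.reverse_append, List.map_append]
  subst hA'
  refine ⟨a', b', A₁.reverse.map m ++ e :: B₁, listEar_append_cons.2 ⟨hA₁', hB₁⟩, ?_, ha', hb', ?_,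
    e, by simp, heK⟩
  · rw [List.append_assoc, ← List.cons_append, ← List.append_assoc (A₁.reverse.map m)] at hd
    exact (disjointPairs_append.1 (disjointPairs_append.1 hd).2.1).1
  · intro x hx
    refine ⟨hW x ?_, ?_⟩
    · simp only [List.mem_append, List.mem_cons] at hx ⊢; tauto
    · rw [List.mem_append, List.mem_cons, mem_reverse_map h1] at hx
      rcases hx with hx | rfl | hx
      · exact fun h => hA₁H _ hx (hH.involution_mem hm h)
      · exact heH
      · exact hB₁H x hx

/-- The last edge of a closed alternating path is allowed. -/
theorem EvenPath.allowedGraph_adj [Finite V] (hm : MaxMat G m) {d p : V} {L : List V}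
    (hL : EvenPath G m d (L ++ [p]) d) (hd : DisjointPairs m (L ++ [p])) :
    (allowedGraph G).Adj (m p) d := by
  obtain ⟨p', hL', rfl, w, hadj, hw⟩ := evenPath_append.1 hL
  obtain rfl : w = d := hw
  obtain ⟨n, hn, hnw, hnp, hoff, hon⟩ := exists_switch hm.1 hL' hd
  have hj := hn.join hnp hnw hadj
  -- Exchanging along the closed path keeps all covered vertices covered, so the new matching is
  -- again maximum and contains the last edge.
  refine allowedGraph_adj_iff.2 ⟨_, hm.of_support_subset hj ?_, by simp [join], hadj.ne⟩
  intro v hv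
  have h1 := hoff v
  have h2 := hon v
  have := hadj.ne
  unfold join
  by_cases hvp : v ∈ L ++ [p'] ∨ m v ∈ L ++ [p']
  · have := (h2 hvp).2
    grind
  · push Not at hvp
    have := h1 hvp.1 hvp.2
    clear h1 h2 hoff hon
    grind

/-- Both ends of the ear are continued inside `U` towards `comp G r`, and the result depends on how
the continuations `A` and `B` first meet. -/
theorem exists_earThrough [Finite V] (hm : MaxMat G m) {r : V} {U W : Set V} (hU : Closed G U)
    (hr : comp G r ⊆ U) (hUW : U \ comp G r ⊆ W)
    (hcrit : Crit G m (comp G r) U) {a b e : V}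
    {E : List V} (hE : ListEar G m a E b) (ha : a ∈ U) (hb : b ∈ U) (hd : DisjointPairs m E)
    (hEW : ∀ e ∈ E, e ∈ W \ U) (he : e ∈ E) :
    ∃ t ∈ U, EarThrough G m (comp G t) W (comp G e) := by
  have h1 := hm.1.1
  obtain ⟨A, g, hA, hAd, hg, hAU⟩ := hcrit.2 a ha
  obtain ⟨B, g', hB, hBd, hg', hBU⟩ := hcrit.2 b hb
  have key : ∀ A B g g' t, EvenPath G m a A g → EvenPath G m b B g' → DisjointPairs m A →
      DisjointPairs m B → (∀ x ∈ A, x ∈ U \ comp G r) → (∀ x ∈ B, x ∈ U \ comp G r) →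
      g ∈ comp G t → g' ∈ comp G t → t ∈ U → (∀ x ∈ B, x ∉ pairs m A) →
      EarThrough G m (comp G t) W (comp G e) := by
    intro A B g g' t hA hB hAd hBd hAU hBU hg hg' ht hAB
    have hAr : ∀ x ∈ A.reverse.map m, x ∈ U \ comp G r := by
      intro x hx
      rw [mem_reverse_map h1] at hx
      have := hU.involution_mem_diff (closed_comp r) hm _ (hAU _ hx)
      rwa [h1] at this
    refine ListEar.earThrough hm (closed_comp t) (L := A.reverse.map m ++ (E ++ B))
      (hA.reverse_append h1 (listEar_append.2 ⟨b, hE, hB⟩)) ?_ hg hg' ?_ (by simp [he])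
      (fun h => (hEW e he).2 ((hU.comp_subset ht) h)) (mem_comp_self e)
    · have hBA : DisjointPairs m (B ++ A.reverse.map m) :=
        hBd.append_of_mem (hAd.reverse h1) (mem_pairs_of_partner h1) hAB
          (fun x hx => .inr ((mem_reverse_map h1).1 hx))
      have := hd.append_of_mem hBA (hU.mem_of_involution_mem hm) (fun x hx => (hEW x hx).2) (by
        intro x hx
        rcases List.mem_append.1 hx with hx | hx
        · exact (hBU x hx).1
        · exact (hAr x hx).1)
      rw [← List.append_assoc] at this
      exact this.perm h1 List.perm_append_comm
    · intro x hx
      simp only [List.mem_append] at hx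
      rcases hx with hx | hx | hx
      · exact hUW (hAr x hx)
      · exact (hEW x hx).1
      · exact hUW (hBU x hx)
  by_cases hx : ∃ x ∈ B, x ∈ pairs m A
  · obtain ⟨B₁, c, B₂, rfl, hc, hB₁⟩ := exists_split_first hx
    obtain ⟨c', hB', hB''⟩ := evenPath_append.1 hB
    obtain rfl := (evenPath_cons.1 hB'').1
    have hB₁d : DisjointPairs m B₁ := (disjointPairs_append.1 hBd).1
    rcases hc with hc | hc
    -- The continuations enter the common matching edge at the same vertex, so the initial parts
    -- close the ear at that vertex.
    · obtain ⟨A₁, A₂, rfl⟩ := List.append_of_mem hc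
      obtain ⟨d, hA', hA''⟩ := evenPath_append.1 hA
      obtain rfl := (evenPath_cons.1 hA'').1
      refine ⟨d, (hAU d (by simp)).1, key A₁ B₁ d d d hA' hB' (disjointPairs_append.1 hAd).1 hB₁d
        (fun x hx => hAU x (by simp [hx])) (fun x hx => hBU x (by simp [hx])) (mem_comp_self _)
        (mem_comp_self _) (hAU d (by simp)).1 (fun x hx h => hB₁ x hx ?_)⟩
      rcases h with h | h
      · exact .inl (by simp [h])
      · exact .inr (by simp [h])
    -- The continuations traverse the common matching edge in opposite directions. With the ear they
    -- form an alternating circuit, whose last edge is allowed and leaves `U`.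
    · exfalso
      obtain ⟨A₁, A₂, rfl⟩ := List.append_of_mem hc
      obtain ⟨d, hA', hA''⟩ := evenPath_append.1 hA
      obtain rfl := (evenPath_cons.1 hA'').1
      obtain ⟨w, haw, hEw⟩ := hE
      have hwE : w ∈ E := by
        cases E with
        | nil => simp at he
        | cons x E => obtain ⟨rfl, -⟩ := hEw; simp
      have hrev := hA'.reverse_append h1 (listEar_nil.2 haw)
      rw [List.append_nil] at hrev
      have hcyc : EvenPath G m w (E ++ (B₁ ++ c' :: A₁.reverse.map m)) w :=
        evenPath_append.2 ⟨b, hEw, evenPath_append.2 ⟨c', hB', evenPath_cons.2 ⟨rfl, hrev⟩⟩⟩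
      have hRU : ∀ x ∈ B₁ ++ c' :: A₁.reverse.map m, x ∈ U := by
        intro x hx
        rw [List.mem_append, List.mem_cons, mem_reverse_map h1] at hx
        rcases hx with hx | rfl | hx
        · exact (hBU x (by simp [hx])).1
        · exact (hBU x (by simp)).1
        · exact hU.mem_of_involution_mem hm _ (hAU (m x) (by simp [hx])).1
      have hRd : DisjointPairs m (B₁ ++ c' :: A₁.reverse.map m) := by
        refine hB₁d.append_of_mem ?_ (mem_pairs_of_partner h1) hB₁ ?_
        · rw [List.append_cons] at hAd
          have := (disjointPairs_append.1 hAd).1.reverse h1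
          simpa [h1] using this
        · intro x hx
          right
          rw [List.mem_cons, mem_reverse_map h1] at hx
          rcases hx with rfl | hx <;> simp_all
      have hcd := hd.append_of_mem hRd (hU.mem_of_involution_mem hm) (fun x hx => (hEW x hx).2) hRU
      rcases List.eq_nil_or_concat' (B₁ ++ c' :: A₁.reverse.map m) with h | ⟨R, p, h⟩
      · simp at h
      rw [h, ← List.append_assoc] at hcyc hcd
      have hadj := hcyc.allowedGraph_adj hm hcd
      have hp : p ∈ U := hRU p (by rw [h]; simp)
      exact (hEW w hwE).2 (hU _ (hU.involution_mem hm hp) _ hadj)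
  · push Not at hx
    exact ⟨r, hr (mem_comp_self r), key A B g g' r hA hB hAd hBd hAU hBU hg hg'
      (hr (mem_comp_self r)) hx⟩

/-! ### From lists to paths and circuits of the graph -/

section Walks

open SimpleGraph

theorem EvenPath.exists_walk (hm : IsMat G m) {z y : V} {L : List V} (hL : EvenPath G m z L y)
    (hd : DisjointPairs m (L ++ [y])) :
    ∃ q : G.Walk z (m y), q.IsPath ∧ (∀ v, v ∈ q.support ↔ v ∈ pairs m (L ++ [y])) ∧
      ∀ x ∈ L ++ [y], s(x, m x) ∈ q.edges := by
  have h1 := hm.1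
  induction L generalizing z with
  | nil =>
    obtain rfl : z = y := hL
    have hz : m z ≠ z := hd.2 z (by simp)
    refine ⟨.cons (hm.2 z hz) .nil, by simp [hz.symm], ?_, by simp⟩
    intro v
    have h1v := h1 v
    have h1z := h1 z
    simp only [Walk.support_cons, Walk.support_nil, List.mem_cons, List.not_mem_nil, or_false,
      pairs, Set.mem_ofPred_eq, List.nil_append]
    grind
  | cons x L ih =>
    obtain ⟨rfl, w, hw, hL⟩ := hL
    rw [List.cons_append, disjointPairs_cons] at hd
    obtain ⟨hd1, hd2, hd3⟩ := hd
    obtain ⟨q, hq, hqs, hqe⟩ := ih hL hd3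
    refine ⟨.cons (hm.2 z hd2) (.cons hw q), ?_, ?_, ?_⟩
    · rw [Walk.isPath_def, Walk.support_cons, Walk.support_cons, List.nodup_cons, List.nodup_cons,
        List.mem_cons, hqs, hqs]
      refine ⟨?_, ?_, (Walk.isPath_def q).1 hq⟩
      · rintro (h | h | h)
        · exact hd2 h.symm
        · exact (hd1 z h).1 rfl
        · exact (hd1 _ h).2 rfl
      · rintro (h | h)
        · exact (hd1 _ h).2 rfl
        · rw [h1] at h; exact (hd1 z h).1 rfl
    · intro v
      have h1v := h1 v
      have h1z := h1 z
      rw [Walk.support_cons, Walk.support_cons, List.mem_cons, List.mem_cons, hqs]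
      simp only [pairs, Set.mem_ofPred_eq, List.cons_append, List.mem_cons]
      grind
    · intro x hx
      rw [List.cons_append, List.mem_cons] at hx
      rw [Walk.edges_cons, Walk.edges_cons]
      rcases hx with rfl | hx
      · simp
      · simp [hqe x hx]

theorem ListEar.exists_isMatchingEar (hm : IsMat G m) {M : G.Subgraph} (hr : Represents m M)
    {Hs K : Set V} (hmH : ∀ v, m v ∈ Hs → v ∈ Hs) {a b e : V} {L : List V}
    (hL : ListEar G m a L b) (hd : DisjointPairs m L) (ha : a ∈ Hs) (hb : b ∈ Hs)
    (hLH : ∀ x ∈ L, x ∉ Hs) (he : e ∈ L) (heK : e ∈ K) :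
    ∃ P : G.Subgraph, IsMatchingEar G M Hs P ∧ Traverses P Hs K := by
  have h1 := hm.1
  obtain ⟨w, haw, hL⟩ := hL
  rcases L.eq_nil_or_concat' with rfl | ⟨L, y, rfl⟩
  · simp at he
  obtain ⟨y', hL', rfl, b', hyb, hb'⟩ := evenPath_append.1 hL
  obtain rfl : b' = b := hb'
  obtain ⟨q, hq, hqs, hqe⟩ := hL'.exists_walk hm hd
  have hqH : ∀ v ∈ q.support, v ∉ Hs := by
    intro v hv hvH
    rcases (hqs v).1 hv with h | h
    · exact hLH v h hvH
    · exact hLH _ h (hmH _ (by rwa [h1]))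
  have haq : a ∉ q.support := fun h => hqH a h ha
  have hbq : b' ∉ q.support := fun h => hqH b' h hb
  have hconc : (q.concat hyb).IsPath := by
    rw [Walk.isPath_def, Walk.support_concat, ← List.concat_eq_append, List.nodup_concat]
    exact ⟨hbq, (Walk.isPath_def q).1 hq⟩
  let p : G.Walk a b' := .cons haw (q.concat hyb)
  have hps : ∀ v, v ∈ p.support ↔ v = a ∨ v ∈ q.support ∨ v = b' := by
    intro v
    simp [p, Walk.support_concat]
  have hpe : ∀ u v, u ∉ Hs → v ∉ Hs → (s(u, v) ∈ p.edges ↔ s(u, v) ∈ q.edges) := by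
    intro u v hu hv
    simp only [p, Walk.edges_cons, Walk.edges_concat, List.mem_cons, List.concat_eq_append,
      List.mem_append, List.not_mem_nil, or_false, Sym2.eq_iff]
    constructor
    · rintro ((⟨rfl, -⟩ | ⟨-, rfl⟩) | h | (⟨-, rfl⟩ | ⟨rfl, -⟩))
      all_goals first | exact h | contradiction
    · exact fun h => .inr (.inl h)
  have hverts : p.toSubgraph.verts ∩ Hs = {a, b'} := by
    ext v
    simp only [Set.mem_inter_iff, Walk.mem_verts_toSubgraph, hps, Set.mem_insert_iff,
      Set.mem_singleton_iff]
    constructor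
    · rintro ⟨h | h | h, hv⟩
      · exact .inl h
      · exact (hqH v h hv).elim
      · exact .inr h
    · rintro (rfl | rfl)
      · exact ⟨.inl rfl, ha⟩
      · exact ⟨.inr (.inr rfl), hb⟩
  have hdel : p.toSubgraph.deleteVerts Hs = q.toSubgraph := by
    have hv : (p.toSubgraph.deleteVerts Hs).verts = q.toSubgraph.verts := by
      ext v
      simp only [Subgraph.deleteVerts_verts, Set.mem_sdiff, Walk.mem_verts_toSubgraph, hps]
      constructor
      · rintro ⟨rfl | h | rfl, hv⟩
        · exact (hv ha).elim
        · exact h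
        · exact (hv hb).elim
      · exact fun h => ⟨.inr (.inl h), hqH v h⟩
    refine Subgraph.ext hv ?_
    ext u v
    simp only [Subgraph.deleteVerts_adj, Walk.mem_verts_toSubgraph,
      Walk.adj_toSubgraph_iff_mem_edges]
    constructor
    · rintro ⟨-, hu, -, hv, h⟩
      exact (hpe u v hu hv).1 h
    · intro h
      have hu := q.fst_mem_support_of_mem_edges h
      have hv := q.snd_mem_support_of_mem_edges h
      exact ⟨(hps u).2 (.inr (.inl hu)), hqH u hu, (hps v).2 (.inr (.inl hv)), hqH v hv,
        (hpe u v (hqH u hu) (hqH v hv)).2 h⟩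
  refine ⟨p.toSubgraph, ⟨?_, ?_⟩, e, ⟨?_, hLH e he⟩, heK⟩
  · by_cases hab : a = b'
    · subst hab
      right
      refine ⟨a, p, ?_, rfl, by rw [hverts]; simp⟩
      rw [Walk.cons_isCycle_iff]
      refine ⟨hconc, fun h => ?_⟩
      rw [Walk.edges_concat, List.concat_eq_append, List.mem_append, List.mem_singleton] at h
      rcases h with h | h
      · exact haq (q.fst_mem_support_of_mem_edges h)
      -- The first and last edges of the circuit differ because the saturated path between them has
      -- distinct ends.
      · have hne := hL'.partner_last_ne h1 hd
        rw [Sym2.eq_iff] at h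
        rcases h with ⟨h, -⟩ | ⟨-, h⟩
        · exact hyb.ne h.symm
        · exact hne h.symm
    · left
      refine ⟨a, b', p, ?_, hab, rfl, hverts⟩
      rw [Walk.cons_isPath_iff]
      refine ⟨hconc, ?_⟩
      rw [Walk.support_concat]
      simp [haq, hab]
  · rw [hdel]
    refine ⟨⟨_, _, q, hq, rfl⟩, fun v hv => ?_⟩
    rw [Walk.mem_verts_toSubgraph, hqs] at hv
    refine ⟨m v, ?_, fun w hw => ((hr v w).1 hw.1).1.symm⟩
    simp only [hr v (m v), Walk.adj_toSubgraph_iff_mem_edges, true_and]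
    rcases hv with hv | hv
    · exact ⟨(hd.2 v hv).symm, hqe v hv⟩
    · have h2 := hd.2 _ hv
      have h3 := hqe _ hv
      rw [h1] at h2 h3
      exact ⟨h2, by rwa [Sym2.eq_swap]⟩
  · rw [Walk.mem_verts_toSubgraph, hps, hqs]
    exact .inr (.inl (.inl he))

end Walks

/-! ### The order and the maximality argument -/

/-- Some critical-inducing set for the factor-component of `s` contains `v`. -/
def CompLE (G : SimpleGraph V) (m : V → V) (s v : V) : Prop :=
  ∃ Z, Closed G Z ∧ Crit G m (comp G s) Z ∧ v ∈ Z

theorem CompLE.trans [Finite V] (hm : MaxMat G m) {s t v : V} (h₁ : CompLE G m s t)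
    (h₂ : CompLE G m t v) : CompLE G m s v := by
  obtain ⟨Z₁, hZ₁, hc₁, ht⟩ := h₁
  obtain ⟨Z₂, hZ₂, hc₂, hv⟩ := h₂
  exact ⟨_, hZ₁.union hZ₂, hc₁.trans hm hZ₁ hc₂ (hZ₁.comp_subset ht), .inr hv⟩

theorem closed_iUnion_comp (E : List V) : Closed G {v | ∃ e ∈ E, v ∈ comp G e} := by
  rintro u ⟨e, he, hu⟩ v hadj
  exact ⟨e, he, closed_comp e u hu v hadj⟩

theorem EarThrough.compLE [Finite V] (hm : MaxMat G m) {s v : V} {W : Set V}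
    (h : EarThrough G m (comp G s) W (comp G v)) (hW : Closed G W)
    (hcons : ∀ e ∈ W, ∀ n, MaxMat G n → n e ≠ e) : CompLE G m s v := by
  obtain ⟨a, b, E, hE, hd, ha, hb, hEW, e, he, hev⟩ := h
  refine ⟨_, (closed_comp s).union (closed_iUnion_comp E),
    (crit_self m _).extend hm (closed_comp s) hE ha hb hd (fun e he => (hEW e he).2) ?_,
    .inr ⟨e, he, ?_⟩⟩
  · intro e he n hn v hv
    exact hcons v (hW.comp_subset (hEW e he).1 hv) n hn
  · rw [comp_eq_of_mem hev]; exact mem_comp_self v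

/-- Each vertex of a critical-inducing set for a factor-component lies above some factor-component
traversed by an ear. -/
theorem exists_earThrough_compLE [Finite V] (hm : MaxMat G m) {r : V} {X : Set V}
    (hX : Closed G X) (hcrit : Crit G m (comp G r) X)
    (hcons : ∀ e ∈ X \ comp G r, ∀ n, MaxMat G n → n e ≠ e) :
    ∀ v ∈ X \ comp G r, ∃ t, EarThrough G m (comp G r) (X \ comp G r) (comp G t) ∧
      CompLE G m t v := by
  have hW : Closed G (X \ comp G r) := fun u hu v hadj =>
    ⟨hX u hu.1 v hadj, fun h => hu.2 (closed_comp r v h u hadj.symm)⟩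
  -- The invariant includes the path property of `U` itself, which `exists_earThrough` needs to
  -- prolong the next ear.
  let Inv : Set V → Prop := fun U => Closed G U ∧ U ⊆ X ∧ Crit G m (comp G r) U ∧
    ∀ v ∈ U \ comp G r, ∃ t, EarThrough G m (comp G r) (X \ comp G r) (comp G t) ∧ CompLE G m t v
  have h0 : Inv (comp G r) :=
    ⟨closed_comp r, hcrit.1, crit_self m _, fun v hv => (hv.2 hv.1).elim⟩
  obtain ⟨U, ⟨hU, hUX, hUc, hUt⟩, hmax⟩ :=
    (Set.toFinite {U : Set V | Inv U}).exists_maximal ⟨_, h0⟩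
  suffices hXU : X ⊆ U from fun v hv => hUt v ⟨hXU hv.1, hv.2⟩
  by_contra hXU
  obtain ⟨w, hwX, hwU⟩ := Set.not_subset.1 hXU
  have hmem : ∀ z ∈ X \ U, ∃ L c, EvenPath G m z L c ∧ DisjointPairs m L ∧ c ∈ U ∧ z ∈ L ∧
      ∀ x ∈ L, x ∈ X \ U := by
    intro z hz
    obtain ⟨L, h, hL, hd, hh, hLX⟩ := hcrit.2 z hz.1
    obtain ⟨L₁, L₂, c, rfl, hL₁, -, hc, -, hL₁U⟩ := hL.truncate (hUc.1 hh)
    refine ⟨L₁, c, hL₁, (disjointPairs_append.1 hd).1, hc, ?_,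
      fun x hx => ⟨(hLX x (by simp [hx])).1, hL₁U x hx⟩⟩
    cases L₁ with
    | nil => obtain rfl : z = c := hL₁; exact (hz.2 hc).elim
    | cons x L => obtain ⟨rfl, -⟩ := hL₁; simp
  -- An edge from `m y'` outside `U` to `c'` in `U`, followed by an alternating path from `m y'`
  -- back to `U`, is an ear relative to `U`.
  obtain ⟨a, b, E, hE, hd, ha, hb, hEX, hEne⟩ : ∃ a b E, ListEar G m a E b ∧
      DisjointPairs m E ∧ a ∈ U ∧ b ∈ U ∧ (∀ e ∈ E, e ∈ X \ U) ∧ ∃ e, e ∈ E := by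
    obtain ⟨L, c, hL, -, hc, hwL, hLX⟩ := hmem w ⟨hwX, hwU⟩
    rcases L.eq_nil_or_concat' with rfl | ⟨L, y, rfl⟩
    · simp at hwL
    obtain ⟨y', -, rfl, c', hadj, hc'⟩ := evenPath_append.1 hL
    obtain rfl : c' = c := hc'
    obtain ⟨L', b, hL', hd, hb, hmem', hLX'⟩ :=
      hmem (m y') (hX.involution_mem_diff hU hm _ (hLX y' (by simp)))
    exact ⟨c', b, L', ⟨_, hadj.symm, hL'⟩, hd, hc, hb, hLX', _, hmem'⟩
  have hEW : ∀ e ∈ E, e ∈ (X \ comp G r) \ U := fun e he =>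
    ⟨⟨(hEX e he).1, fun h => (hEX e he).2 (hUc.1 h)⟩, (hEX e he).2⟩
  have hInv : Inv (U ∪ {v | ∃ e ∈ E, v ∈ comp G e}) := by
    refine ⟨hU.union (closed_iUnion_comp E), Set.union_subset hUX ?_,
      hUc.extend hm hU hE ha hb hd (fun e he => (hEX e he).2)
        fun e he n hn v hv => hcons v (hW.comp_subset (hEW e he).1 hv) n hn, ?_⟩
    · rintro v ⟨e, he, hv⟩
      exact hX.comp_subset (hEX e he).1 hv
    · rintro v ⟨hv | ⟨e, he, hv⟩, hvr⟩
      · exact hUt v ⟨hv, hvr⟩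
      · obtain ⟨t, htU, ht⟩ := exists_earThrough hm hU hUc.1 (Set.sdiff_subset_sdiff_left hUX) hUc hE
          ha hb hd hEW he
        rw [← comp_eq_of_mem hv] at ht
        -- Either the prolonged ear is already relative to `comp G r`, or `t` lies above some `s`
        -- met by such an ear and the prolonged ear places `v` above `t`.
        by_cases htr : t ∈ comp G r
        · rw [comp_eq_of_mem htr] at ht
          exact ⟨v, ht, comp G v, closed_comp v, crit_self m _, mem_comp_self v⟩
        · obtain ⟨s, hs, hst⟩ := hUt t ⟨htU, htr⟩
          exact ⟨s, hs, hst.trans hm (ht.compLE hm hW hcons)⟩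
  obtain ⟨e, he⟩ := hEne
  exact (hEX e he).2 (hmax hInv Set.subset_union_left (.inr ⟨e, he, mem_comp_self e⟩))

theorem CompLE.basilicaLE [Finite V] (hm : MaxMat G m) {s v : V} (h : CompLE G m s v) :
    BasilicaLE G ((⊤ : G.Subgraph).induce (comp G s)) ((⊤ : G.Subgraph).induce (comp G v)) := by
  obtain ⟨Z, hZ, hc, hv⟩ := h
  exact ⟨Z, (isCriticalInducing_iff hm (mem_factorComponents_iff.2 ⟨s, rfl⟩)).2 ⟨hZ, hc⟩,
    hZ.comp_subset hv⟩

end Basilica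

theorem mainTheorem8 {V : Type*} [Finite V] (G : SimpleGraph V) (M : G.Subgraph)
    (hM : Basilica.IsMaximumMatching G M) (G₁ G₂ : G.Subgraph)
    (h₁ : G₁ ∈ Basilica.factorComponents G) (h₂ : G₂ ∈ Basilica.factorComponents G)
    (hne : G₁ ≠ G₂) (hle : Basilica.BasilicaLE G G₁ G₂)
    (himm : Basilica.IsImmediate G G₁ G₂) :
    ∃ P : G.Subgraph, Basilica.IsMatchingEar G M G₁.verts P ∧
      Basilica.Traverses P G₁.verts G₂.verts := by
  open Basilica in
  obtain ⟨m, hm, hr⟩ := hM.1.exists_represents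
  have hmax := (hr.isMaximumMatching_iff hM.1 hm).1 hM
  obtain ⟨X, hX, hvX⟩ := hle
  have hX' := fun n (hn : MaxMat G n) => (isCriticalInducing_iff hn h₁).1 hX
  obtain ⟨r, rfl⟩ := mem_factorComponents_iff.1 h₁
  obtain ⟨v, rfl⟩ := mem_factorComponents_iff.1 h₂
  have hclosed := (hX' m hmax).1
  -- All maximum matchings must be considered, since different allowed edges may come from different
  -- ones.
  have hcons : ∀ e ∈ X \ comp G r, ∀ n, MaxMat G n → n e ≠ e :=
    fun e he n hn => (hX' n hn).2.ne he
  have hW : Closed G (X \ comp G r) := fun u hu w hadj =>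
    ⟨hclosed u hu.1 w hadj, fun h => hu.2 (closed_comp r w h u hadj.symm)⟩
  have hv : v ∈ X \ comp G r :=
    ⟨hvX (mem_comp_self v), fun h => hne (by rw [comp_eq_of_mem h])⟩
  obtain ⟨t, ht, htv⟩ :=
    exists_earThrough_compLE hmax hclosed (hX' m hmax).2 hcons v hv
  have hrt := ht.compLE hmax hW hcons
  obtain ⟨a, b, E, hE, hd, ha, hb, hEW, e, he, het⟩ := ht
  have heq := himm _ (mem_factorComponents_iff.2 ⟨t, rfl⟩) (hrt.basilicaLE hmax)
    (htv.basilicaLE hmax)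
  refine hE.exists_isMatchingEar hm hr ((closed_comp r).mem_of_involution_mem hmax) hd ha hb
    (fun x hx => (hEW x hx).2) he ?_
  rcases heq with heq | heq
  · have := congrArg SimpleGraph.Subgraph.verts heq
    exact ((hEW e he).2 (show e ∈ comp G r from (Set.ext_iff.1 this e).2 het)).elim
  · have := congrArg SimpleGraph.Subgraph.verts heq
    exact (Set.ext_iff.1 this e).2 het
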